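/- Let $m,p,r,s\ge 0$ be integers and let $\Phi$ be a natural operator on $m$-dimensional smooth (Hausdorff, second countable) manifolds that transforms a $(1,p)$-tensor field $\varphi$ and an $(r,s)$-tensor field $\psi$ into an $(r,s+p)$-tensor field $\Phi(\varphi,\psi)$. That is, $\Phi$ is a system of maps $\Phi_M\colon C^\infty(T^{(1,p)}M)\times C^\infty(T^{(r,s)}M)\to C^\infty(T^{(r,s+p)}M)$, one for each such manifold $M$, that commutes with diffeomorphisms and with restriction to open submanifolds. Suppose that every $\Phi_M$ is $\mathbb{R}$-bilinear and that $\Phi$ has finite order: there is an integer $k\ge 0$ such that, for all $M$ and $x\in M$, the value $\Phi_M(\varphi,\psi)(x)$ depends only on the $k$-jets of $\varphi$ and $\psi$ at $x$. Then $\Phi$ is of order one: $\Phi_M(\varphi,\psi)(x)$ depends only on the $1$-jets of $\varphi$ and $\psi$ at $x$, and it depends only on their values at $x$ only if $\Phi=0$. Moreover there are tensors $A$ and $B$ on $\mathbb{R}^m$, of types $(r+p+s+1,\,s+p+1+r)$ and $(r+p+1+s,\,s+p+1+r)$ respectively, both invariant under $GL(m,\mathbb{R})$ and depending only on $\Phi$,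 such that for every $M$, all $\varphi,\psi$, and in all local coordinates on $M$, $$\Phi(\varphi,\psi)^{i_1\dots i_r}_{j_1\dots j_{s+p}} = A^{i_1\dots i_r m_1\dots m_p t_1\dots t_{s+1}}_{j_1\dots j_{s+p}kq_1\dots q_r}\,\varphi^k_{m_1\dots m_p}\,\partial_{t_{s+1}}\psi^{q_1\dots q_r}_{t_1\dots t_s} + B^{i_1\dots i_r m_1\dots m_{p+1}t_1\dots t_s}_{j_1\dots j_{s+p}kq_1\dots q_r}\,\psi^{q_1\dots q_r}_{t_1\dots t_s}\,\partial_{m_{p+1}}\varphi^k_{m_1\dots m_p},$$ with summation over repeated indices. -/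

import Mathlib

open scoped Manifold ContDiff

/-- Tensors of type `(r, s)` (`r` times contravariant, `s` times covariant) on a finite-dimensional
real vector space `V`, as multilinear functions of `r` covectors and `s` vectors. -/
abbrev TensorSpace (r s : ℕ) (V : Type*) [AddCommGroup V] [Module ℝ V] : Type _ :=
  MultilinearMap ℝ (fun _ : Fin r => Module.Dual ℝ V) (MultilinearMap ℝ (fun _ : Fin s => V) ℝ)

/-- The linear form `d^i` on `ℝ^m`, i.e. the `i`-th coordinate. -/
noncomputable def stdCovector {m : ℕ} (i : Fin m) : Module.Dual ℝ (EuclideanSpace ℝ (Fin m)) :=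
  (EuclideanSpace.proj i : EuclideanSpace ℝ (Fin m) →L[ℝ] ℝ).toLinearMap

/-- The vector `∂_i` of `ℝ^m`, i.e. the `i`-th vector of the standard basis. -/
noncomputable def stdVector {m : ℕ} (i : Fin m) : EuclideanSpace ℝ (Fin m) :=
  EuclideanSpace.single i (1 : ℝ)

/-- The component `T^{i_1 … i_r}_{j_1 … j_s}` of a tensor on `ℝ^m`. -/
noncomputable def TensorSpace.component {m r s : ℕ} (T : TensorSpace r s (EuclideanSpace ℝ (Fin m)))
    (i : Fin r → Fin m) (j : Fin s → Fin m) : ℝ :=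
  T (fun a => stdCovector (i a)) (fun b => stdVector (j b))

/-- Absolute invariant tensors: the natural action of every `g ∈ GL(V)` fixes `T`. -/
def TensorSpace.IsGLInvariant {r s : ℕ} {V : Type*} [AddCommGroup V] [Module ℝ V]
    (T : TensorSpace r s V) : Prop :=
  ∀ (g : V ≃ₗ[ℝ] V) (β : Fin r → Module.Dual ℝ V) (v : Fin s → V),
    T (fun a => β a ∘ₗ g.symm.toLinearMap) (fun b => g (v b)) = T β v

section Fields

variable {m r s : ℕ} {M : Type*} [TopologicalSpace M]
  [ChartedSpace (EuclideanSpace ℝ (Fin m)) M]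

/-- The coordinate covector `d^i` at the point `x` of the domain of the chart `e`. -/
noncomputable def coordCovector (e : OpenPartialHomeomorph M (EuclideanSpace ℝ (Fin m)))
    (x : M) (i : Fin m) : Module.Dual ℝ (TangentSpace (𝓡 m) x) :=
  (stdCovector i : Module.Dual ℝ (TangentSpace (𝓡 m) (e x))) ∘ₗ
    (mfderiv (𝓡 m) (𝓡 m) e x).toLinearMap

/-- The coordinate vector `∂_j` at the point of the chart `e` that has coordinates `y`. -/
noncomputable def coordVector (e : OpenPartialHomeomorph M (EuclideanSpace ℝ (Fin m)))
    (y : EuclideanSpace ℝ (Fin m)) (j : Fin m) : TangentSpace (𝓡 m) (e.symm y) :=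
  mfderiv (𝓡 m) (𝓡 m) e.symm y (stdVector j : TangentSpace (𝓡 m) y)

/-- The component `T^{i_1 … i_r}_{j_1 … j_s}` of a (not necessarily smooth) tensor field `T` in the
chart `e`, as a function of the coordinates; it is meaningful on `e.target`. -/
noncomputable def coordComponent (e : OpenPartialHomeomorph M (EuclideanSpace ℝ (Fin m)))
    (T : ∀ x : M, TensorSpace r s (TangentSpace (𝓡 m) x))
    (i : Fin r → Fin m) (j : Fin s → Fin m) (y : EuclideanSpace ℝ (Fin m)) : ℝ :=
  T (e.symm y) (fun a => coordCovector e (e.symm y) (i a)) (fun b => coordVector e y (j b))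

variable (m r s M) in
/-- The real vector space of smooth tensor fields of type `(r, s)` on an `m`-dimensional manifold:
the components in every chart of the smooth structure are smooth functions. -/
noncomputable def TensorField : Submodule ℝ (∀ x : M, TensorSpace r s (TangentSpace (𝓡 m) x)) where
  carrier := {T | ∀ e ∈ IsManifold.maximalAtlas (𝓡 m) ∞ M, ∀ (i : Fin r → Fin m)
    (j : Fin s → Fin m), ContDiffOn ℝ ∞ (coordComponent e T i j) e.target}
  zero_mem' := fun _ _ _ _ => contDiffOn_const (c := (0 : ℝ))
  add_mem' := fun hS hT e he i j => (hS e he i j).add (hT e he i j)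
  smul_mem' := fun c _ hT e he i j => (hT e he i j).const_smul c

/-- Two tensor fields have the same `k`-jet at `x`: in a chart around `x` the partial derivatives up
to order `k` of their components agree at `x`. This does not depend on the chart, and we use the
preferred one. -/
def SameJet (k : ℕ) (S T : TensorField m r s M) (x : M) : Prop :=
  ∀ (i : Fin r → Fin m) (j : Fin s → Fin m), ∀ l ≤ k,
    iteratedFDeriv ℝ l (coordComponent (chartAt (EuclideanSpace ℝ (Fin m)) x) S.1 i j)
        (chartAt (EuclideanSpace ℝ (Fin m)) x x) =
      iteratedFDeriv ℝ l (coordComponent (chartAt (EuclideanSpace ℝ (Fin m)) x) T.1 i j)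
        (chartAt (EuclideanSpace ℝ (Fin m)) x x)

/-- The tensor fields `S` on `M` and `T` on `N` correspond to each other under `f : M → N`. When the
tangent maps of `f` are invertible (as they are for a diffeomorphism, or for the inclusion of an
open submanifold) this says that `S` is the pullback of `T`. -/
def TensorField.Related {N : Type*} [TopologicalSpace N]
    [ChartedSpace (EuclideanSpace ℝ (Fin m)) N] (f : M → N)
    (S : TensorField m r s M) (T : TensorField m r s N) : Prop :=
  ∀ (x : M) (β : Fin r → Module.Dual ℝ (TangentSpace (𝓡 m) (f x)))
    (v : Fin s → TangentSpace (𝓡 m) x),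
    S.1 x (fun a => β a ∘ₗ (mfderiv (𝓡 m) (𝓡 m) f x).toLinearMap) v =
      T.1 (f x) β (fun b => mfderiv (𝓡 m) (𝓡 m) f x (v b))

end Fields

/-- A natural operator transforming pairs of tensor fields, of types `(r₁, s₁)` and `(r₂, s₂)`, into
tensor fields of type `(r₃, s₃)`: a system of maps, one for every `m`-dimensional smooth manifold
(Hausdorff and second countable), that commutes with diffeomorphisms and with the restriction to
open submanifolds. -/
structure NaturalOperator (m r₁ s₁ r₂ s₂ r₃ s₃ : ℕ) where
  toFun : ∀ (M : Type) [TopologicalSpace M] [ChartedSpace (EuclideanSpace ℝ (Fin m)) M]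
    [IsManifold (𝓡 m) ∞ M] [T2Space M] [SecondCountableTopology M],
    TensorField m r₁ s₁ M → TensorField m r₂ s₂ M → TensorField m r₃ s₃ M
  natural : ∀ (M N : Type)
    [TopologicalSpace M] [ChartedSpace (EuclideanSpace ℝ (Fin m)) M]
    [IsManifold (𝓡 m) ∞ M] [T2Space M] [SecondCountableTopology M]
    [TopologicalSpace N] [ChartedSpace (EuclideanSpace ℝ (Fin m)) N]
    [IsManifold (𝓡 m) ∞ N] [T2Space N] [SecondCountableTopology N]
    (f : M ≃ₘ^∞⟮𝓡 m, 𝓡 m⟯ N)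
    (φ : TensorField m r₁ s₁ M) (φ' : TensorField m r₁ s₁ N)
    (ψ : TensorField m r₂ s₂ M) (ψ' : TensorField m r₂ s₂ N),
    TensorField.Related f φ φ' → TensorField.Related f ψ ψ' →
      TensorField.Related f (toFun M φ ψ) (toFun N φ' ψ')
  restrict : ∀ (M : Type) [TopologicalSpace M] [ChartedSpace (EuclideanSpace ℝ (Fin m)) M]
    [IsManifold (𝓡 m) ∞ M] [T2Space M] [SecondCountableTopology M]
    (U : TopologicalSpace.Opens M)
    (φ : TensorField m r₁ s₁ U) (φ' : TensorField m r₁ s₁ M)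
    (ψ : TensorField m r₂ s₂ U) (ψ' : TensorField m r₂ s₂ M),
    TensorField.Related ((↑) : U → M) φ φ' → TensorField.Related ((↑) : U → M) ψ ψ' →
      TensorField.Related ((↑) : U → M) (toFun U φ ψ) (toFun M φ' ψ')

namespace NaturalOperator

variable {m r₁ s₁ r₂ s₂ r₃ s₃ : ℕ}

/-- The operator is `ℝ`-bilinear on every manifold. -/
def IsBilinear (Φ : NaturalOperator m r₁ s₁ r₂ s₂ r₃ s₃) : Prop :=
  ∀ (M : Type) [TopologicalSpace M] [ChartedSpace (EuclideanSpace ℝ (Fin m)) M]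
    [IsManifold (𝓡 m) ∞ M] [T2Space M] [SecondCountableTopology M],
    (∀ φ : TensorField m r₁ s₁ M, IsLinearMap ℝ (fun ψ => Φ.toFun M φ ψ)) ∧
      ∀ ψ : TensorField m r₂ s₂ M, IsLinearMap ℝ (fun φ => Φ.toFun M φ ψ)

/-- The operator is of order at most `k`: its value at a point depends only on the `k`-jets of the
two arguments at this point. -/
def OrderAtMost (Φ : NaturalOperator m r₁ s₁ r₂ s₂ r₃ s₃) (k : ℕ) : Prop :=
  ∀ (M : Type) [TopologicalSpace M] [ChartedSpace (EuclideanSpace ℝ (Fin m)) M]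
    [IsManifold (𝓡 m) ∞ M] [T2Space M] [SecondCountableTopology M]
    (φ φ' : TensorField m r₁ s₁ M) (ψ ψ' : TensorField m r₂ s₂ M) (x : M),
    SameJet k φ φ' x → SameJet k ψ ψ' x →
      (Φ.toFun M φ ψ).1 x = (Φ.toFun M φ' ψ').1 x

/-- The operator vanishes on every manifold. -/
def IsZero (Φ : NaturalOperator m r₁ s₁ r₂ s₂ r₃ s₃) : Prop :=
  ∀ (M : Type) [TopologicalSpace M] [ChartedSpace (EuclideanSpace ℝ (Fin m)) M]
    [IsManifold (𝓡 m) ∞ M] [T2Space M] [SecondCountableTopology M]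
    (φ : TensorField m r₁ s₁ M) (ψ : TensorField m r₂ s₂ M), Φ.toFun M φ ψ = 0

end NaturalOperator

/-! Naturality reduces everything to the origin of `ℝ^m`. A chart identifies an open piece of `M`
with an open set of `ℝ^m`, so compatibility with restrictions and diffeomorphisms shows that the
components of `Φ(φ,ψ)` near a point are those obtained on `ℝ^m` from any fields that extend the
components of `φ` and `ψ` there (`NaturalOperator.coordComponent_eq_of_eqOn`, with extensions from
`exists_flat_extension`). Translations then move the point to the origin. What remains is one
bilinear map, `NaturalOperator.atZero`, compatible with `GL(m)`.

The decisive group element is the dilation `x ↦ 2x`. Pullback along it turns an `(r,s)`-field `T(x)`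
into `2^(s-r) T(2x)`. For the types `(1,p)`, `(r,s)` and `(r,s+p)` these weights cancel except for
one factor, which comes from the single upper index of `φ`: replacing `φ(x), ψ(x)` by `φ(2x), ψ(2x)`
doubles the value at the origin. On terms of degrees `a` and `b` the same replacement multiplies by
`2^(a+b)`, so only `a + b = 1` survives. For fields that merely vanish to orders `a` and `b`, `φ(2x)
- 2^a φ(x)` vanishes to order `a + 1`, and an induction that ends at the finite order of `Φ` gives
zero whenever `a + b ≥ 2` (`NaturalOperator.atZero_eq_zero_of_vanishesToOrder`). A Taylor expansion
of degree one is thus enough (`NaturalOperator.atZero_eq`).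

The two surviving terms are equivariant trilinear operations on two tensors and a covector, the
direction of the derivative. Their coefficients are `A` and `B`, and equivariance becomes
invariance. Order one is read off the resulting formula. An operator of order zero does not see
linear parts, so both terms vanish. -/

section Algebra

/-! ### Tensors expanded in a frame and its coframe. -/

variable {m r s : ℕ} {V : Type*} [AddCommGroup V] [Module ℝ V]

/-- The tensor `u₁ ⊗ … ⊗ u_r ⊗ ξ₁ ⊗ … ⊗ ξ_s`. -/
noncomputable def pureTensor (u : Fin r → V) (ξ : Fin s → Module.Dual ℝ V) : TensorSpace r s V :=
  ((MultilinearMap.mkPiAlgebra ℝ (Fin r) ℝ).compLinearMap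
    (fun a => Module.Dual.eval ℝ V (u a))).smulRight
      ((MultilinearMap.mkPiAlgebra ℝ (Fin s) ℝ).compLinearMap ξ)

@[simp]
theorem pureTensor_apply (u : Fin r → V) (ξ : Fin s → Module.Dual ℝ V)
    (β : Fin r → Module.Dual ℝ V) (v : Fin s → V) :
    pureTensor u ξ β v = (∏ a, β a (u a)) * ∏ b, ξ b (v b) := by
  simp [pureTensor]

/-- Only the spanning half of duality is needed: evaluating a covector on the expansion of a vector
gives the expansion of the covector, and multilinearity does the rest. The orthogonality relations
enter only in `sum_smul_pureTensor_apply`. -/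
theorem TensorSpace.apply_eq_sum {b : Fin m → V} {d : Fin m → Module.Dual ℝ V}
    (hbd : ∀ v, v = ∑ i, d i v • b i) (T : TensorSpace r s V)
    (β : Fin r → Module.Dual ℝ V) (v : Fin s → V) :
    T β v = ∑ i : Fin r → Fin m, ∑ j : Fin s → Fin m,
      (∏ a, β a (b (i a))) * (∏ c, d (j c) (v c)) * T (fun a => d (i a)) (fun c => b (j c)) := by
  have hβ : β = fun a => ∑ i, β a (b i) • d i := by
    funext a
    ext w
    conv_lhs => rw [hbd w]
    simp [mul_comm]
  have hv : v = fun c => ∑ j, d j (v c) • b j := by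
    funext c
    exact hbd (v c)
  conv_lhs => rw [hβ, hv]
  rw [T.map_sum (fun a i => β a (b i) • d i), sum_apply]
  refine Finset.sum_congr rfl fun i _ => ?_
  rw [MultilinearMap.map_sum]
  refine Finset.sum_congr rfl fun j _ => ?_
  rw [MultilinearMap.map_smul_univ, MultilinearMap.map_smul_univ]
  simp [mul_assoc, mul_left_comm]

theorem TensorSpace.eq_sum {b : Fin m → V} {d : Fin m → Module.Dual ℝ V}
    (hbd : ∀ v, v = ∑ i, d i v • b i) (T : TensorSpace r s V) :
    T = ∑ i : Fin r → Fin m, ∑ j : Fin s → Fin m,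
      T (fun a => d (i a)) (fun c => b (j c)) •
        pureTensor (fun a => b (i a)) (fun c => d (j c)) := by
  ext β v
  rw [TensorSpace.apply_eq_sum hbd]
  simp [mul_comm]

theorem TensorSpace.ext_frame {b : Fin m → V} {d : Fin m → Module.Dual ℝ V}
    (hbd : ∀ v, v = ∑ i, d i v • b i) {S T : TensorSpace r s V}
    (h : ∀ (i : Fin r → Fin m) (j : Fin s → Fin m),
      S (fun a => d (i a)) (fun c => b (j c)) = T (fun a => d (i a)) (fun c => b (j c))) :
    S = T := by
  rw [TensorSpace.eq_sum hbd S, TensorSpace.eq_sum hbd T]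
  simp only [h]

theorem sum_smul_pureTensor_apply {b : Fin m → V} {d : Fin m → Module.Dual ℝ V}
    (hdb : ∀ i j, d i (b j) = if i = j then 1 else 0)
    (c : (Fin r → Fin m) → (Fin s → Fin m) → ℝ) (i : Fin r → Fin m) (j : Fin s → Fin m) :
    (∑ i' : Fin r → Fin m, ∑ j' : Fin s → Fin m,
      c i' j' • pureTensor (fun a => b (i' a)) (fun k => d (j' k)))
        (fun a => d (i a)) (fun k => b (j k)) = c i j := by
  simp only [sum_apply, smul_apply, pureTensor_apply, hdb,
    smul_eq_mul]
  rw [Finset.sum_eq_single i, Finset.sum_eq_single j]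
  · simp
  · intro j' _ hj
    obtain ⟨k, hk⟩ := Function.ne_iff.1 hj
    rw [Finset.prod_eq_zero (Finset.mem_univ k) (if_neg hk)]
    simp
  · simp
  · intro i' _ hi
    obtain ⟨a, ha⟩ := Function.ne_iff.1 hi
    refine Finset.sum_eq_zero fun j' _ => ?_
    rw [Finset.prod_eq_zero (Finset.mem_univ a) (if_neg (Ne.symm ha))]
    simp
  · simp

end Algebra

/-! ### The standard frame of `ℝ^m`. -/

section StandardFrame

variable {m : ℕ}

@[simp]
theorem stdCovector_apply (i : Fin m) (v : EuclideanSpace ℝ (Fin m)) : stdCovector i v = v i :=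
  rfl

theorem stdCovector_stdVector (i j : Fin m) :
    stdCovector i (stdVector j) = if i = j then (1 : ℝ) else 0 := by
  simp [stdVector]

theorem eq_sum_stdVector (v : EuclideanSpace ℝ (Fin m)) :
    v = ∑ i, stdCovector i v • stdVector i := by
  ext k
  simp [stdVector, Pi.single_apply]

theorem dual_eq_sum_stdCovector (τ : Module.Dual ℝ (EuclideanSpace ℝ (Fin m))) :
    τ = ∑ i, τ (stdVector i) • stdCovector i := by
  ext v
  conv_lhs => rw [eq_sum_stdVector v]
  simp only [map_sum, map_smul, LinearMap.sum_apply, LinearMap.smul_apply, smul_eq_mul]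
  exact Finset.sum_congr rfl fun i _ => mul_comm _ _

end StandardFrame

/-! ### Coordinate frames, change of coordinates, and fields with prescribed components. -/

section Frames

variable {m r s : ℕ} {M : Type*} [TopologicalSpace M]
  [ChartedSpace (EuclideanSpace ℝ (Fin m)) M]
  {e : OpenPartialHomeomorph M (EuclideanSpace ℝ (Fin m))}

local notation "𝔼" => EuclideanSpace ℝ (Fin m)

/-- The coordinate vector `∂_j` of the chart `e` at the point `x` of its domain. -/
noncomputable def frameVector (e : OpenPartialHomeomorph M 𝔼) (x : M) (j : Fin m) :
    TangentSpace (𝓡 m) x :=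
  (mfderiv (𝓡 m) (𝓡 m) e.symm (e x) (stdVector j : 𝔼) : 𝔼)

theorem coordComponent_apply {x : M} (hx : x ∈ e.source)
    (T : ∀ x : M, TensorSpace r s (TangentSpace (𝓡 m) x))
    (i : Fin r → Fin m) (j : Fin s → Fin m) :
    coordComponent e T i j (e x) =
      T x (fun a => coordCovector e x (i a)) (fun b => frameVector e x (j b)) := by
  -- The points `e.symm (e x)` and `x` are equal only propositionally, so their tangent spaces are
  -- different types. Generalizing the base point lets the equality be substituted.
  have key : ∀ z : M, z = x →
      (T z (fun a => coordCovector e z (i a)) fun b =>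
        (mfderiv (𝓡 m) (𝓡 m) e.symm (e x) (stdVector (j b) : 𝔼) : 𝔼)) =
      T x (fun a => coordCovector e x (i a)) (fun b => frameVector e x (j b)) := by
    rintro z rfl
    rfl
  exact key _ (e.left_inv hx)

theorem mdifferentiable_of_mem_maximalAtlas (he : e ∈ IsManifold.maximalAtlas (𝓡 m) ∞ M) :
    e.MDifferentiable (𝓡 m) (𝓡 m) :=
  ⟨(contMDiffOn_of_mem_maximalAtlas he).mdifferentiableOn (by simp),
    (contMDiffOn_symm_of_mem_maximalAtlas he).mdifferentiableOn (by simp)⟩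

theorem mfderiv_frameVector (he : e ∈ IsManifold.maximalAtlas (𝓡 m) ∞ M) {x : M}
    (hx : x ∈ e.source) (j : Fin m) :
    mfderiv (𝓡 m) (𝓡 m) e x (frameVector e x j) = (stdVector j : 𝔼) := by
  have hd := mdifferentiable_of_mem_maximalAtlas he
  have h1 : mfderiv (𝓡 m) (𝓡 m) (e ∘ e.symm) (e x) (stdVector j : 𝔼) =
      mfderiv (𝓡 m) (𝓡 m) e x (mfderiv (𝓡 m) (𝓡 m) e.symm (e x) (stdVector j : 𝔼) : 𝔼) :=
    mfderiv_comp_apply_of_eq (e x) (hd.mdifferentiableAt hx)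
      (hd.mdifferentiableAt_symm (e.map_source hx)) (e.left_inv hx) _
  have h2 : mfderiv (𝓡 m) (𝓡 m) (e ∘ e.symm) (e x) = ContinuousLinearMap.id ℝ _ := by
    rw [← mfderiv_id (I := 𝓡 m) (x := e x)]
    apply Filter.EventuallyEq.mfderiv_eq
    filter_upwards [e.open_target.mem_nhds (e.map_source hx)] with z hz
    exact e.right_inv hz
  exact h1.symm.trans (by rw [h2]; rfl)

theorem coordCovector_frameVector (he : e ∈ IsManifold.maximalAtlas (𝓡 m) ∞ M) {x : M}
    (hx : x ∈ e.source) (i j : Fin m) :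
    coordCovector e x i (frameVector e x j) = if i = j then 1 else 0 := by
  rw [← stdCovector_stdVector, ← mfderiv_frameVector he hx j]
  rfl

theorem eq_sum_frameVector (he : e ∈ IsManifold.maximalAtlas (𝓡 m) ∞ M) {x : M}
    (hx : x ∈ e.source) (v : TangentSpace (𝓡 m) x) :
    v = ∑ i, coordCovector e x i v • frameVector e x i := by
  have hd := mdifferentiable_of_mem_maximalAtlas he
  apply hd.mfderiv_injective hx
  rw [map_sum]
  simp only [map_smul, mfderiv_frameVector he hx]
  exact eq_sum_stdVector (m := m) _

theorem coordComponent_ext (he : e ∈ IsManifold.maximalAtlas (𝓡 m) ∞ M) {x : M}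
    (hx : x ∈ e.source) {S T : ∀ x : M, TensorSpace r s (TangentSpace (𝓡 m) x)}
    (h : ∀ i j, coordComponent e S i j (e x) = coordComponent e T i j (e x)) : S x = T x := by
  refine TensorSpace.ext_frame (eq_sum_frameVector he hx) fun i j => ?_
  rw [← coordComponent_apply hx, ← coordComponent_apply hx, h]

/-- The change of coordinates of the components of a tensor field. -/
theorem coordComponent_change {e' : OpenPartialHomeomorph M 𝔼}
    (he : e ∈ IsManifold.maximalAtlas (𝓡 m) ∞ M) (he' : e' ∈ IsManifold.maximalAtlas (𝓡 m) ∞ M)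
    (T : ∀ x : M, TensorSpace r s (TangentSpace (𝓡 m) x))
    (i' : Fin r → Fin m) (j' : Fin s → Fin m) {x : M} (hx : x ∈ e.source) (hx' : x ∈ e'.source) :
    coordComponent e' T i' j' (e' x) = ∑ i : Fin r → Fin m, ∑ j : Fin s → Fin m,
      (∏ a, fderiv ℝ (e' ∘ e.symm) (e x) (stdVector (i a)) (i' a)) *
        (∏ c, fderiv ℝ (e ∘ e'.symm) (e' x) (stdVector (j' c)) (j c)) *
        coordComponent e T i j (e x) := by
  have key : ∀ {f g : OpenPartialHomeomorph M 𝔼}, f ∈ IsManifold.maximalAtlas (𝓡 m) ∞ M →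
      g ∈ IsManifold.maximalAtlas (𝓡 m) ∞ M → x ∈ f.source → x ∈ g.source → ∀ k l,
      coordCovector g x k (frameVector f x l) =
        fderiv ℝ (g ∘ f.symm) (f x) (stdVector l) k := by
    intro f g hf hg hxf hxg k l
    have := mfderiv_comp_apply_of_eq (f := f.symm) (g := g) (f x)
      ((mdifferentiable_of_mem_maximalAtlas hg).mdifferentiableAt hxg)
      ((mdifferentiable_of_mem_maximalAtlas hf).mdifferentiableAt_symm (f.map_source hxf))
      (f.left_inv hxf) (stdVector l : 𝔼)
    rw [mfderiv_eq_fderiv] at this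
    exact congrArg (fun v : 𝔼 => v k) this.symm
  rw [coordComponent_apply hx', TensorSpace.apply_eq_sum (eq_sum_frameVector he hx)]
  refine Finset.sum_congr rfl fun i _ => Finset.sum_congr rfl fun j _ => ?_
  rw [coordComponent_apply hx]
  simp only [key he he' hx hx', key he' he hx' hx]

theorem contDiffOn_transition {e' : OpenPartialHomeomorph M 𝔼}
    (he : e ∈ IsManifold.maximalAtlas (𝓡 m) ∞ M) (he' : e' ∈ IsManifold.maximalAtlas (𝓡 m) ∞ M) :
    ContDiffOn ℝ ∞ (e' ∘ e.symm) (e.target ∩ e.symm ⁻¹' e'.source) := by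
  rw [← contMDiffOn_iff_contDiffOn]
  exact (contMDiffOn_of_mem_maximalAtlas he').comp
    ((contMDiffOn_symm_of_mem_maximalAtlas he).mono Set.inter_subset_left)
    Set.inter_subset_right

/-- Smoothness of a tensor field may be checked in one global chart. -/
theorem mem_tensorField_of_global_chart (he : e ∈ IsManifold.maximalAtlas (𝓡 m) ∞ M)
    (hs : e.source = Set.univ) {T : ∀ x : M, TensorSpace r s (TangentSpace (𝓡 m) x)}
    (hT : ∀ i j, ContDiffOn ℝ ∞ (coordComponent e T i j) e.target) : T ∈ TensorField m r s M := by
  intro e' he' i' j'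
  have hmem : ∀ x, x ∈ e.source := fun x => hs ▸ Set.mem_univ x
  have h1 : ContDiffOn ℝ ∞ (e ∘ e'.symm) e'.target :=
    (contDiffOn_transition he' he).mono fun y hy => ⟨hy, hmem _⟩
  have ho : IsOpen (e.target ∩ e.symm ⁻¹' e'.source) := e.isOpen_inter_preimage_symm e'.open_source
  have hm : Set.MapsTo (e ∘ e'.symm) e'.target (e.target ∩ e.symm ⁻¹' e'.source) := by
    intro y hy
    refine ⟨e.map_source (hmem _), ?_⟩
    simp only [Function.comp_apply, Set.mem_preimage, e.left_inv (hmem _)]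
    exact e'.map_target hy
  have h2 : ∀ v : 𝔼, ContDiffOn ℝ ∞ (fun y => fderiv ℝ (e' ∘ e.symm) ((e ∘ e'.symm) y) v)
      e'.target := fun v =>
    (((contDiffOn_transition he he').fderiv_of_isOpen ho (by simp)).comp h1 hm).clm_apply
      contDiffOn_const
  have h3 : ∀ v : 𝔼, ContDiffOn ℝ ∞ (fun y => fderiv ℝ (e ∘ e'.symm) y v) e'.target := fun v =>
    (h1.fderiv_of_isOpen e'.open_target (by simp)).clm_apply contDiffOn_const
  have hco : ∀ (f : 𝔼 → 𝔼) (t : Set 𝔼) (k : Fin m), ContDiffOn ℝ ∞ f t →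
      ContDiffOn ℝ ∞ (fun y => f y k) t := fun f t k hf =>
    (EuclideanSpace.proj k : 𝔼 →L[ℝ] ℝ).contDiff.comp_contDiffOn hf
  have hsum : ContDiffOn ℝ ∞ (fun y => ∑ i : Fin r → Fin m, ∑ j : Fin s → Fin m,
      (∏ a, fderiv ℝ (e' ∘ e.symm) ((e ∘ e'.symm) y) (stdVector (i a)) (i' a)) *
        (∏ c, fderiv ℝ (e ∘ e'.symm) y (stdVector (j' c)) (j c)) *
        coordComponent e T i j ((e ∘ e'.symm) y)) e'.target := by
    refine ContDiffOn.sum fun i _ => ContDiffOn.sum fun j _ => ?_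
    refine ((contDiffOn_prod fun a _ => hco _ _ (i' a) (h2 (stdVector (i a)))).mul
      (contDiffOn_prod fun c _ => hco _ _ (j c) (h3 (stdVector (j' c))))).mul
        ((hT i j).comp h1 fun y hy => (hm hy).1)
  refine hsum.congr fun y hy => ?_
  have := coordComponent_change he he' T i' j' (hmem (e'.symm y)) (e'.map_target hy)
  rwa [e'.right_inv hy] at this

/-- The tensor field with the given components in a chart. -/
noncomputable def tensorOfComponents (e : OpenPartialHomeomorph M 𝔼)
    (c : (Fin r → Fin m) → (Fin s → Fin m) → 𝔼 → ℝ) (x : M) :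
    TensorSpace r s (TangentSpace (𝓡 m) x) :=
  ∑ i : Fin r → Fin m, ∑ j : Fin s → Fin m,
    c i j (e x) • pureTensor (fun a => frameVector e x (i a)) (fun b => coordCovector e x (j b))

theorem coordComponent_tensorOfComponents (he : e ∈ IsManifold.maximalAtlas (𝓡 m) ∞ M)
    (c : (Fin r → Fin m) → (Fin s → Fin m) → 𝔼 → ℝ) (i : Fin r → Fin m) (j : Fin s → Fin m)
    {y : 𝔼} (hy : y ∈ e.target) : coordComponent e (tensorOfComponents e c) i j y = c i j y := by
  have h := coordComponent_apply (e.map_target hy) (tensorOfComponents e c) i j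
  rw [e.right_inv hy] at h
  rw [h]
  unfold tensorOfComponents
  rw [sum_smul_pureTensor_apply (coordCovector_frameVector he (e.map_target hy))
    (fun i j => c i j (e (e.symm y))), e.right_inv hy]

/-- The smooth tensor field with the given smooth components in a global chart. -/
noncomputable def fieldOfComponents (he : e ∈ IsManifold.maximalAtlas (𝓡 m) ∞ M)
    (hs : e.source = Set.univ) (c : (Fin r → Fin m) → (Fin s → Fin m) → 𝔼 → ℝ)
    (hc : ∀ i j, ContDiffOn ℝ ∞ (c i j) e.target) : TensorField m r s M :=
  ⟨tensorOfComponents e c, mem_tensorField_of_global_chart he hs fun i j =>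
    (hc i j).congr fun _ hy => coordComponent_tensorOfComponents he c i j hy⟩

end Frames

/-! ### Related fields read in charts, and restricted charts. -/

section Relating

variable {m r s : ℕ} {M N : Type*} [TopologicalSpace M]
  [ChartedSpace (EuclideanSpace ℝ (Fin m)) M] [TopologicalSpace N]
  [ChartedSpace (EuclideanSpace ℝ (Fin m)) N]
  {e : OpenPartialHomeomorph M (EuclideanSpace ℝ (Fin m))}
  {e' : OpenPartialHomeomorph N (EuclideanSpace ℝ (Fin m))}

/-- Fields correspond to each other under a map that is the identity in charts iff they have the
same components in these charts. -/
theorem TensorField.related_iff_coordComponent (he : e ∈ IsManifold.maximalAtlas (𝓡 m) ∞ M)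
    (he' : e' ∈ IsManifold.maximalAtlas (𝓡 m) ∞ N) (hs : e.source = Set.univ) {f : M → N}
    (hf : ∀ x, f x ∈ e'.source) (hef : ∀ x, e' (f x) = e x)
    (S : TensorField m r s M) (T : TensorField m r s N) :
    TensorField.Related f S T ↔ ∀ i j, ∀ y ∈ e.target,
      coordComponent e S.1 i j y = coordComponent e' T.1 i j y := by
  have hmem : ∀ x, x ∈ e.source := fun x => hs ▸ Set.mem_univ x
  have hde := mdifferentiable_of_mem_maximalAtlas he
  have hde' := mdifferentiable_of_mem_maximalAtlas he'
  have hfd : ∀ x, MDifferentiableAt (𝓡 m) (𝓡 m) f x := by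
    intro x
    have hfe : f = e'.symm ∘ e := by
      funext z
      rw [Function.comp_apply, ← hef, e'.left_inv (hf z)]
    rw [hfe]
    refine MDifferentiableAt.comp x (hde'.mdifferentiableAt_symm ?_)
      (hde.mdifferentiableAt (hmem x))
    rw [← hef]
    exact e'.map_source (hf x)
  -- Differentiating `e' ∘ f = e` shows that the tangent map of `f` matches the two coordinate
  -- frames and coframes.
  have hD : ∀ (x : M) (v : TangentSpace (𝓡 m) x),
      (mfderiv (𝓡 m) (𝓡 m) e' (f x) (mfderiv (𝓡 m) (𝓡 m) f x v) : EuclideanSpace ℝ (Fin m)) =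
        mfderiv (𝓡 m) (𝓡 m) e x v := by
    intro x v
    have h := mfderiv_comp_apply x (hde'.mdifferentiableAt (hf x)) (hfd x) v
    have hc : (e' : N → EuclideanSpace ℝ (Fin m)) ∘ f = e := funext hef
    rw [hc] at h
    exact h.symm
  have hco : ∀ (x : M) (i : Fin m) (v : TangentSpace (𝓡 m) x),
      coordCovector e' (f x) i (mfderiv (𝓡 m) (𝓡 m) f x v) = coordCovector e x i v := by
    intro x i v
    exact congrArg (fun w : EuclideanSpace ℝ (Fin m) => w i) (hD x v)
  have hv : ∀ (x : M) (j : Fin m),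
      mfderiv (𝓡 m) (𝓡 m) f x (frameVector e x j) = frameVector e' (f x) j := by
    intro x j
    apply hde'.mfderiv_injective (hf x)
    rw [mfderiv_frameVector he' (hf x)]
    exact (hD x _).trans (mfderiv_frameVector he (hmem x) j)
  constructor
  · intro h i j y hy
    obtain ⟨x, rfl⟩ : ∃ x, e x = y := ⟨e.symm y, e.right_inv hy⟩
    have h1 := h x (fun a => coordCovector e' (f x) (i a)) (fun b => frameVector e x (j b))
    have h2 : ∀ a, coordCovector e' (f x) (i a) ∘ₗ (mfderiv (𝓡 m) (𝓡 m) f x).toLinearMap =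
        coordCovector e x (i a) := fun a => LinearMap.ext (hco x (i a))
    simp only [h2, hv] at h1
    rw [coordComponent_apply (hmem x), h1, ← hef, coordComponent_apply (hf x)]
  · intro h x β v
    rw [TensorSpace.apply_eq_sum (eq_sum_frameVector he (hmem x)),
      TensorSpace.apply_eq_sum (eq_sum_frameVector he' (hf x))]
    refine Finset.sum_congr rfl fun i _ => Finset.sum_congr rfl fun j _ => ?_
    have h1 := h i j (e x) (e.map_source (hmem x))
    rw [coordComponent_apply (hmem x), ← hef, coordComponent_apply (hf x)] at h1
    rw [h1]
    simp only [hco, ← hv]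
    rfl

/-- The diffeomorphism that two global charts with the same target define. -/
noncomputable def diffeomorphOfCharts (he : e ∈ IsManifold.maximalAtlas (𝓡 m) ∞ M)
    (he' : e' ∈ IsManifold.maximalAtlas (𝓡 m) ∞ N) (hs : e.source = Set.univ)
    (hs' : e'.source = Set.univ) (ht : e.target = e'.target) : M ≃ₘ^∞⟮𝓡 m, 𝓡 m⟯ N where
  toFun x := e'.symm (e x)
  invFun x := e.symm (e' x)
  left_inv x := by
    have hx : x ∈ e.source := hs ▸ Set.mem_univ x
    change e.symm (e' (e'.symm (e x))) = x
    rw [e'.right_inv (ht ▸ e.map_source hx), e.left_inv hx]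
  right_inv x := by
    have hx : x ∈ e'.source := hs' ▸ Set.mem_univ x
    change e'.symm (e (e.symm (e' x))) = x
    rw [e.right_inv (ht ▸ e'.map_source hx), e'.left_inv hx]
  contMDiff_toFun := by
    rw [← contMDiffOn_univ]
    refine (contMDiffOn_symm_of_mem_maximalAtlas he').comp
      ((contMDiffOn_of_mem_maximalAtlas he).mono hs.ge) fun x _ => ?_
    exact ht ▸ e.map_source (hs ▸ Set.mem_univ x)
  contMDiff_invFun := by
    rw [← contMDiffOn_univ]
    refine (contMDiffOn_symm_of_mem_maximalAtlas he).comp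
      ((contMDiffOn_of_mem_maximalAtlas he').mono hs'.ge) fun x _ => ?_
    exact ht ▸ e'.map_source (hs' ▸ Set.mem_univ x)

/-- A chart of the open submanifold `U` is itself the restriction of a chart of `M`, and transition
maps between restricted charts are restrictions of transition maps of `M`. -/
theorem subtypeRestr_mem_maximalAtlas [IsManifold (𝓡 m) ∞ M]
    (he : e ∈ IsManifold.maximalAtlas (𝓡 m) ∞ M) {U : TopologicalSpace.Opens M}
    (hU : Nonempty U) : e.subtypeRestr hU ∈ IsManifold.maximalAtlas (𝓡 m) ∞ U := by
  have key : ∀ {f g : OpenPartialHomeomorph M (EuclideanSpace ℝ (Fin m))},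
      f ∈ IsManifold.maximalAtlas (𝓡 m) ∞ M → g ∈ IsManifold.maximalAtlas (𝓡 m) ∞ M →
      (f.subtypeRestr hU).symm ≫ₕ g.subtypeRestr hU ∈ contDiffGroupoid ∞ (𝓡 m) := by
    intro f g hf hg
    refine StructureGroupoid.mem_of_eqOnSource _ (closedUnderRestriction' ?_ ?_)
      (f.subtypeRestr_symm_trans_subtypeRestr hU g)
    · exact StructureGroupoid.compatible_of_mem_maximalAtlas hf hg
    · exact f.isOpen_inter_preimage_symm U.2
  intro f hf
  obtain ⟨x, rfl⟩ := TopologicalSpace.Opens.chart_eq hU hf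
  have hx := IsManifold.chart_mem_maximalAtlas (I := 𝓡 m) (n := ∞) (x : M)
  exact ⟨key he hx, key hx he⟩

theorem refl_mem_maximalAtlas :
    OpenPartialHomeomorph.refl (EuclideanSpace ℝ (Fin m)) ∈
      IsManifold.maximalAtlas (𝓡 m) ∞ (EuclideanSpace ℝ (Fin m)) :=
  IsManifold.subset_maximalAtlas (by simp)

end Relating

/-! ### Passing from a manifold to `ℝ^m`. -/

section Transfer

variable {m r₁ s₁ r₂ s₂ r₃ s₃ : ℕ}

local notation "𝔼" => EuclideanSpace ℝ (Fin m)

/-- In a chart, a natural operator acts on components as it does on `ℝ^m`. -/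
theorem NaturalOperator.coordComponent_eq_of_eqOn (Φ : NaturalOperator m r₁ s₁ r₂ s₂ r₃ s₃)
    {M : Type} [TopologicalSpace M] [ChartedSpace (EuclideanSpace ℝ (Fin m)) M]
    [IsManifold (𝓡 m) ∞ M] [T2Space M] [SecondCountableTopology M]
    {e : OpenPartialHomeomorph M 𝔼} (he : e ∈ IsManifold.maximalAtlas (𝓡 m) ∞ M)
    {B : TopologicalSpace.Opens 𝔼} (hB : (B : Set 𝔼) ⊆ e.target)
    {φ : TensorField m r₁ s₁ M} {ψ : TensorField m r₂ s₂ M}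
    {φ' : TensorField m r₁ s₁ 𝔼} {ψ' : TensorField m r₂ s₂ 𝔼}
    (hφ : ∀ i j, ∀ y ∈ B, coordComponent e φ.1 i j y =
      coordComponent (OpenPartialHomeomorph.refl 𝔼) φ'.1 i j y)
    (hψ : ∀ i j, ∀ y ∈ B, coordComponent e ψ.1 i j y =
      coordComponent (OpenPartialHomeomorph.refl 𝔼) ψ'.1 i j y) :
    ∀ i j, ∀ y ∈ B, coordComponent e (Φ.toFun M φ ψ).1 i j y =
      coordComponent (OpenPartialHomeomorph.refl 𝔼) (Φ.toFun 𝔼 φ' ψ').1 i j y := by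
  intro i j y hy
  -- The comparison runs along `M ⊇ U ≅ B ⊆ ℝ^m`, where `U` is the part of the chart domain lying
  -- over `B` and the middle diffeomorphism is the chart.
  let U : TopologicalSpace.Opens M := ⟨e.source ∩ e ⁻¹' B, e.isOpen_inter_preimage B.2⟩
  have hUs : ∀ x : U, (x : M) ∈ e.source := fun x => x.2.1
  have hBU : ∀ z ∈ B, e.symm z ∈ U := fun z hz =>
    ⟨e.map_target (hB hz), by simpa [e.right_inv (hB hz)] using hz⟩
  have hU : Nonempty U := ⟨⟨e.symm y, hBU y hy⟩⟩
  have hBne : Nonempty B := ⟨⟨y, hy⟩⟩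
  set eU := e.subtypeRestr hU with heU
  set eB := (OpenPartialHomeomorph.refl 𝔼).subtypeRestr hBne with heB
  have hmU : eU ∈ IsManifold.maximalAtlas (𝓡 m) ∞ U := subtypeRestr_mem_maximalAtlas he hU
  have hmB : eB ∈ IsManifold.maximalAtlas (𝓡 m) ∞ B :=
    subtypeRestr_mem_maximalAtlas refl_mem_maximalAtlas hBne
  have hsU : eU.source = Set.univ := by
    rw [heU, OpenPartialHomeomorph.subtypeRestr_source]
    exact Set.eq_univ_of_forall hUs
  have hsB : eB.source = Set.univ := by
    rw [heB, OpenPartialHomeomorph.subtypeRestr_source]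
    rfl
  have htU : eU.target = B := by
    ext z
    constructor
    · intro hz
      rw [← eU.right_inv hz]
      exact (eU.symm z).2.2
    · intro hz
      have := e.map_subtype_source hU (x := ⟨e.symm z, hBU z hz⟩) (e.map_target (hB hz))
      rwa [e.right_inv (hB hz)] at this
  have htB : eB.target = B := by
    ext z
    constructor
    · intro hz
      rw [← eB.right_inv hz]
      exact (eB.symm z).2
    · intro hz
      exact (OpenPartialHomeomorph.refl 𝔼).map_subtype_source hBne (x := ⟨z, hz⟩) trivial
  have hsm : ∀ {r s : ℕ} (T : TensorField m r s M) i j,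
      ContDiffOn ℝ ∞ (coordComponent e T.1 i j) B := fun T i j => (T.2 e he i j).mono hB
  -- The restrictions to `U` and to `B` are built from the same component functions in global
  -- charts, so all the relations below become equalities of components.
  let onU : ∀ {r s : ℕ}, TensorField m r s M → TensorField m r s U := fun T =>
    fieldOfComponents hmU hsU (coordComponent e T.1) fun i j => htU ▸ hsm T i j
  let onB : ∀ {r s : ℕ}, TensorField m r s M → TensorField m r s B := fun T =>
    fieldOfComponents hmB hsB (coordComponent e T.1) fun i j => htB ▸ hsm T i j
  have honU : ∀ {r s : ℕ} (T : TensorField m r s M) i j, ∀ z ∈ eU.target,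
      coordComponent eU (onU T).1 i j z = coordComponent e T.1 i j z := fun T i j z hz =>
    coordComponent_tensorOfComponents hmU _ i j hz
  have honB : ∀ {r s : ℕ} (T : TensorField m r s M) i j, ∀ z ∈ eB.target,
      coordComponent eB (onB T).1 i j z = coordComponent e T.1 i j z := fun T i j z hz =>
    coordComponent_tensorOfComponents hmB _ i j hz
  have relU : ∀ {r s : ℕ} (S : TensorField m r s U) (T : TensorField m r s M),
      TensorField.Related ((↑) : U → M) S T ↔ ∀ i j, ∀ y ∈ eU.target,
        coordComponent eU S.1 i j y = coordComponent e T.1 i j y :=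
    TensorField.related_iff_coordComponent hmU he hsU hUs fun _ => rfl
  have relB : ∀ {r s : ℕ} (S : TensorField m r s B) (T : TensorField m r s 𝔼),
      TensorField.Related ((↑) : B → 𝔼) S T ↔ ∀ i j, ∀ y ∈ eB.target,
        coordComponent eB S.1 i j y =
          coordComponent (OpenPartialHomeomorph.refl 𝔼) T.1 i j y :=
    TensorField.related_iff_coordComponent hmB refl_mem_maximalAtlas hsB (fun _ => trivial)
      fun _ => rfl
  let D := diffeomorphOfCharts hmU hmB hsU hsB (htU.trans htB.symm)
  have relD : ∀ {r s : ℕ} (S : TensorField m r s U) (T : TensorField m r s B),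
      TensorField.Related D S T ↔ ∀ i j, ∀ y ∈ eU.target,
        coordComponent eU S.1 i j y = coordComponent eB T.1 i j y := by
    refine TensorField.related_iff_coordComponent hmU hmB hsU (fun x => hsB ▸ Set.mem_univ _)
      fun x => eB.right_inv ?_
    rw [htB, ← htU]
    exact eU.map_source (hsU ▸ Set.mem_univ x)
  have h1 := (relU _ _).1 (Φ.restrict M U (onU φ) φ (onU ψ) ψ ((relU _ _).2 (honU φ))
    ((relU _ _).2 (honU ψ))) i j y (htU ▸ hy)
  have hD : ∀ {r s : ℕ} (T : TensorField m r s M), TensorField.Related D (onU T) (onB T) := by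
    intro r s T
    refine (relD _ _).2 fun i j z hz => ?_
    rw [honU T i j z hz, honB T i j z (by rwa [htB, ← htU])]
  have h2 := (relD _ _).1 (Φ.natural U B D (onU φ) (onB φ) (onU ψ) (onB ψ) (hD φ) (hD ψ))
    i j y (htU ▸ hy)
  have hR : ∀ {r s : ℕ} (T : TensorField m r s M) (T' : TensorField m r s 𝔼),
      (∀ i j, ∀ y ∈ B, coordComponent e T.1 i j y =
        coordComponent (OpenPartialHomeomorph.refl 𝔼) T'.1 i j y) →
      TensorField.Related ((↑) : B → 𝔼) (onB T) T' := by
    intro r s T T' h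
    refine (relB _ _).2 fun i j z hz => ?_
    rw [honB T i j z hz, h i j z (by rwa [htB] at hz)]
  have h3 := (relB _ _).1 (Φ.restrict 𝔼 B (onB φ) φ' (onB ψ) ψ' (hR φ φ' hφ) (hR ψ ψ' hψ))
    i j y (htB ▸ hy)
  rw [← h1, h2, h3]

end Transfer

/-! ### Tensor fields on `ℝ^m`: dilations, orders of vanishing, Taylor expansion, linear maps and
translations. -/

section Flat

variable {m r s : ℕ}

local notation "𝔼" => EuclideanSpace ℝ (Fin m)

theorem coordCovector_refl (x : 𝔼) (i : Fin m) :
    coordCovector (OpenPartialHomeomorph.refl 𝔼) x i = stdCovector i := by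
  have : mfderiv (𝓡 m) (𝓡 m) (OpenPartialHomeomorph.refl 𝔼) x = ContinuousLinearMap.id ℝ _ :=
    mfderiv_id
  rw [coordCovector, this]
  rfl

theorem coordVector_refl (x : 𝔼) (j : Fin m) :
    coordVector (OpenPartialHomeomorph.refl 𝔼) x j = (stdVector j : 𝔼) := by
  have : mfderiv (𝓡 m) (𝓡 m) (OpenPartialHomeomorph.refl 𝔼).symm x =
    ContinuousLinearMap.id ℝ _ := mfderiv_id
  rw [coordVector, this]
  rfl

theorem coordComponent_refl (T : 𝔼 → TensorSpace r s 𝔼) (i : Fin r → Fin m) (j : Fin s → Fin m)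
    (x : 𝔼) : coordComponent (OpenPartialHomeomorph.refl 𝔼) T i j x = (T x).component i j := by
  unfold coordComponent
  simp only [coordCovector_refl, coordVector_refl]
  rfl

/-- The tensor field on `ℝ^m` given by a tensor-valued function with smooth components. -/
noncomputable def flatField (F : 𝔼 → TensorSpace r s 𝔼)
    (hF : ∀ i j, ContDiff ℝ ∞ fun x => (F x).component i j) : TensorField m r s 𝔼 :=
  ⟨F, mem_tensorField_of_global_chart refl_mem_maximalAtlas rfl fun i j =>
    ((hF i j).contDiffOn).congr fun x _ => coordComponent_refl F i j x⟩

/-- The value of a tensor field on `ℝ^m` at a point. -/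
noncomputable def valueAt (x : 𝔼) : TensorField m r s 𝔼 →ₗ[ℝ] TensorSpace r s 𝔼 where
  toFun T := T.1 x
  map_add' _ _ := rfl
  map_smul' _ _ := rfl

@[simp]
theorem valueAt_flatField (F : 𝔼 → TensorSpace r s 𝔼)
    (hF : ∀ i j, ContDiff ℝ ∞ fun x => (F x).component i j) (x : 𝔼) :
    valueAt x (flatField F hF) = F x :=
  rfl

theorem flat_ext {S T : TensorField m r s 𝔼} (h : ∀ x, valueAt x S = valueAt x T) : S = T :=
  Subtype.ext (funext h)

/-- The components of a tensor field on `ℝ^m`. -/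
noncomputable def fieldComp (T : TensorField m r s 𝔼) (i : Fin r → Fin m) (j : Fin s → Fin m)
    (x : 𝔼) : ℝ :=
  (valueAt x T).component i j

theorem coordComponent_refl_eq_fieldComp (T : TensorField m r s 𝔼) :
    coordComponent (OpenPartialHomeomorph.refl 𝔼) T.1 = fieldComp T := by
  funext i j x
  exact coordComponent_refl T.1 i j x

theorem contDiff_fieldComp (T : TensorField m r s 𝔼) (i : Fin r → Fin m) (j : Fin s → Fin m) :
    ContDiff ℝ ∞ (fieldComp T i j) := by
  rw [← coordComponent_refl_eq_fieldComp, ← contDiffOn_univ]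
  exact T.2 _ refl_mem_maximalAtlas i j

theorem fieldComp_add (S T : TensorField m r s 𝔼) (i : Fin r → Fin m) (j : Fin s → Fin m) :
    fieldComp (S + T) i j = fieldComp S i j + fieldComp T i j :=
  rfl

theorem fieldComp_smul (c : ℝ) (T : TensorField m r s 𝔼) (i : Fin r → Fin m) (j : Fin s → Fin m) :
    fieldComp (c • T) i j = c • fieldComp T i j :=
  rfl

/-- The field of constant tensors. -/
noncomputable def constField : TensorSpace r s 𝔼 →ₗ[ℝ] TensorField m r s 𝔼 where
  toFun T := flatField (fun _ => T) fun _ _ => contDiff_const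
  map_add' _ _ := rfl
  map_smul' _ _ := rfl

@[simp]
theorem valueAt_constField (T : TensorSpace r s 𝔼) (x : 𝔼) : valueAt x (constField T) = T :=
  rfl

/-- The tensor field `x ↦ τ x • T`. -/
noncomputable def linearField (τ : Module.Dual ℝ 𝔼) (T : TensorSpace r s 𝔼) :
    TensorField m r s 𝔼 :=
  flatField (fun x => τ x • T) fun _ _ =>
    (LinearMap.toContinuousLinearMap τ).contDiff.mul contDiff_const

@[simp]
theorem valueAt_linearField (τ : Module.Dual ℝ 𝔼) (T : TensorSpace r s 𝔼) (x : 𝔼) :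
    valueAt x (linearField τ T) = τ x • T :=
  rfl

/-- `linearField` as a bilinear map. -/
noncomputable def linearFieldₗ :
    Module.Dual ℝ 𝔼 →ₗ[ℝ] TensorSpace r s 𝔼 →ₗ[ℝ] TensorField m r s 𝔼 :=
  LinearMap.mk₂ ℝ linearField
    (fun _ _ _ => flat_ext fun x => by simp [add_smul])
    (fun _ _ _ => flat_ext fun x => by simp [mul_smul])
    (fun _ _ _ => flat_ext fun x => by simp)
    (fun c τ T => flat_ext fun x => by simp [smul_comm c])

/-- The tensor field `x ↦ T (2 • x)`. -/
noncomputable def dilate (T : TensorField m r s 𝔼) : TensorField m r s 𝔼 :=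
  flatField (fun x => valueAt ((2 : ℝ) • x) T) fun i j =>
    (contDiff_fieldComp T i j).comp (contDiff_id.const_smul (2 : ℝ))

theorem fieldComp_dilate (T : TensorField m r s 𝔼) (i : Fin r → Fin m) (j : Fin s → Fin m) :
    fieldComp (dilate T) i j = fun x => fieldComp T i j ((2 : ℝ) • x) :=
  rfl

/-- The field `x ↦ T (x + a)`. -/
noncomputable def translateField (a : 𝔼) (T : TensorField m r s 𝔼) : TensorField m r s 𝔼 :=
  flatField (fun x => valueAt (x + a) T) fun i j =>
    (contDiff_fieldComp T i j).comp (contDiff_id.add contDiff_const)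

theorem fieldComp_translateField (a : 𝔼) (T : TensorField m r s 𝔼) (i : Fin r → Fin m)
    (j : Fin s → Fin m) : fieldComp (translateField a T) i j = fun x => fieldComp T i j (x + a) :=
  rfl

/-- The components vanish at the origin together with their derivatives of order less than `a`. -/
def VanishesToOrder (a : ℕ) (T : TensorField m r s 𝔼) : Prop :=
  ∀ i j, ∀ l < a, iteratedFDeriv ℝ l (fieldComp T i j) 0 = 0

theorem VanishesToOrder.add {a : ℕ} {S T : TensorField m r s 𝔼} (hS : VanishesToOrder a S)
    (hT : VanishesToOrder a T) : VanishesToOrder a (S + T) := by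
  intro i j l hl
  rw [fieldComp_add, iteratedFDeriv_add_apply
    (contDiff_infty.1 (contDiff_fieldComp S i j) l).contDiffAt
    (contDiff_infty.1 (contDiff_fieldComp T i j) l).contDiffAt, hS i j l hl, hT i j l hl, add_zero]

theorem VanishesToOrder.mono {a b : ℕ} (h : b ≤ a) {T : TensorField m r s 𝔼}
    (hT : VanishesToOrder a T) : VanishesToOrder b T :=
  fun i j l hl => hT i j l (hl.trans_le h)

theorem VanishesToOrder.dilate {a : ℕ} {T : TensorField m r s 𝔼} (hT : VanishesToOrder a T) :
    VanishesToOrder a (dilate T) := by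
  intro i j l hl
  rw [fieldComp_dilate,
    iteratedFDeriv_comp_const_smul _ (contDiff_infty.1 (contDiff_fieldComp T i j) l)]
  simp [hT i j l hl]

/-- At the origin the derivative of order `l` of `T(2x)` is `2^l` times that of `T`. Below order `a`
both vanish, and at order `a` the subtraction cancels them exactly. This is the substitute for
splitting off the homogeneous part of degree `a`. -/
theorem VanishesToOrder.dilate_sub {a : ℕ} {T : TensorField m r s 𝔼} (hT : VanishesToOrder a T) :
    VanishesToOrder (a + 1) (_root_.dilate T + (-(2 : ℝ) ^ a) • T) := by
  intro i j l hl
  have hs : ∀ S : TensorField m r s 𝔼, ContDiffAt ℝ l (fieldComp S i j) 0 := fun S =>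
    (contDiff_infty.1 (contDiff_fieldComp S i j) l).contDiffAt
  rw [fieldComp_add, iteratedFDeriv_add_apply (hs _) (hs _), fieldComp_smul,
    iteratedFDeriv_const_smul_apply (hs _), fieldComp_dilate,
    iteratedFDeriv_comp_const_smul _ (contDiff_infty.1 (contDiff_fieldComp T i j) l)]
  rcases Nat.lt_succ_iff_lt_or_eq.1 hl with h | rfl
  · simp [hT i j l h]
  · simp

theorem vanishesToOrder_one {T : TensorField m r s 𝔼} (hT : valueAt 0 T = 0) :
    VanishesToOrder 1 T := by
  intro i j l hl
  obtain rfl : l = 0 := by omega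
  ext
  simp [fieldComp, hT, TensorSpace.component]

theorem vanishesToOrder_two {T : TensorField m r s 𝔼} (hT : valueAt 0 T = 0)
    (hT' : ∀ i j, fderiv ℝ (fieldComp T i j) 0 = 0) : VanishesToOrder 2 T := by
  intro i j l hl
  rcases Nat.lt_succ_iff_lt_or_eq.1 hl with h | rfl
  · exact vanishesToOrder_one hT i j l h
  · ext v
    simp [iteratedFDeriv_one_apply, hT']

/-- Vanishing to order `k + 1` concerns derivatives of order strictly below `k + 1`, which is
exactly the `k`-jet. -/
theorem sameJet_zero_of_vanishesToOrder {k : ℕ} {T : TensorField m r s 𝔼}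
    (hT : VanishesToOrder (k + 1) T) : SameJet k T 0 0 := by
  intro i j l hl
  rw [chartAt_self_eq, coordComponent_refl_eq_fieldComp, coordComponent_refl_eq_fieldComp]
  have h0 : fieldComp (0 : TensorField m r s 𝔼) i j = fun _ => 0 := by
    funext x
    simp [fieldComp, TensorSpace.component]
  rw [h0, iteratedFDeriv_fun_zero]
  exact hT i j l (by omega)

/-- The coefficient of `x_l` in the Taylor expansion of a field at the origin. -/
noncomputable def partialAtZero (T : TensorField m r s 𝔼) (l : Fin m) : TensorSpace r s 𝔼 :=
  ∑ i : Fin r → Fin m, ∑ j : Fin s → Fin m, fderiv ℝ (fieldComp T i j) 0 (stdVector l) •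
    pureTensor (fun a => stdVector (i a)) (fun b => stdCovector (j b))

theorem component_partialAtZero (T : TensorField m r s 𝔼) (l : Fin m) (i : Fin r → Fin m)
    (j : Fin s → Fin m) :
    (partialAtZero T l).component i j = fderiv ℝ (fieldComp T i j) 0 (stdVector l) :=
  sum_smul_pureTensor_apply stdCovector_stdVector
    (fun i j => fderiv ℝ (fieldComp T i j) 0 (stdVector l)) i j

/-- The part of degree one of the Taylor expansion of a field at the origin. -/
noncomputable def linearPart (T : TensorField m r s 𝔼) : TensorField m r s 𝔼 :=
  ∑ l, linearField (stdCovector l) (partialAtZero T l)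

theorem fieldComp_linearPart (T : TensorField m r s 𝔼) (i : Fin r → Fin m) (j : Fin s → Fin m) :
    fieldComp (linearPart T) i j = fderiv ℝ (fieldComp T i j) 0 := by
  funext x
  conv_rhs => rw [eq_sum_stdVector x]
  simp only [fieldComp, linearPart, map_sum, valueAt_linearField, map_smul, smul_eq_mul]
  unfold TensorSpace.component
  simp only [sum_apply, smul_apply, smul_eq_mul]
  refine Finset.sum_congr rfl fun l _ => ?_
  congr 1
  exact component_partialAtZero T l i j

theorem valueAt_linearPart (T : TensorField m r s 𝔼) : valueAt 0 (linearPart T) = 0 := by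
  simp [linearPart]

theorem vanishesToOrder_linearPart (T : TensorField m r s 𝔼) :
    VanishesToOrder 1 (linearPart T) :=
  vanishesToOrder_one (valueAt_linearPart T)

/-- The difference between a field and its Taylor polynomial of degree one at the origin. -/
noncomputable def taylorRemainder (T : TensorField m r s 𝔼) : TensorField m r s 𝔼 :=
  T + (-1 : ℝ) • (constField (valueAt 0 T) + linearPart T)

theorem eq_taylor (T : TensorField m r s 𝔼) :
    T = constField (valueAt 0 T) + (linearPart T + taylorRemainder T) := by
  refine flat_ext fun x => ?_
  simp only [taylorRemainder, map_add, map_smul]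
  module

theorem vanishesToOrder_taylorRemainder (T : TensorField m r s 𝔼) :
    VanishesToOrder 2 (taylorRemainder T) := by
  refine vanishesToOrder_two ?_ fun i j => ?_
  · simp only [taylorRemainder, map_add, map_smul, valueAt_constField, valueAt_linearPart]
    module
  have hd : DifferentiableAt ℝ (fieldComp T i j) 0 :=
    (contDiff_fieldComp T i j).contDiffAt.differentiableAt (by simp)
  have hc : fieldComp (constField (valueAt 0 T)) i j = fun _ => fieldComp T i j 0 := rfl
  rw [taylorRemainder, fieldComp_add, fieldComp_smul, fieldComp_add, fieldComp_linearPart, hc,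
    fderiv_add hd (by fun_prop), fderiv_const_smul (by fun_prop),
    fderiv_add (by fun_prop) (by fun_prop)]
  simp

theorem dilate_constField (T : TensorSpace r s 𝔼) : dilate (constField T) = constField T :=
  rfl

/-- The chain rule form of being related under a diffeomorphism of `ℝ^m`. -/
theorem related_iff_fderiv (g : 𝔼 → 𝔼) (S T : TensorField m r s 𝔼) :
    TensorField.Related g S T ↔ ∀ (x : 𝔼) (β : Fin r → Module.Dual ℝ 𝔼) (v : Fin s → 𝔼),
      valueAt x S (fun a => β a ∘ₗ (fderiv ℝ g x).toLinearMap) v =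
        valueAt (g x) T β (fun b => fderiv ℝ g x (v b)) := by
  unfold TensorField.Related
  simp only [mfderiv_eq_fderiv]
  rfl

/-- A linear automorphism of `ℝ^m` as a diffeomorphism. -/
noncomputable def linearDiffeomorph (g : 𝔼 ≃ₗ[ℝ] 𝔼) : 𝔼 ≃ₘ^∞⟮𝓡 m, 𝓡 m⟯ 𝔼 :=
  g.toContinuousLinearEquiv.toDiffeomorph

theorem related_linearDiffeomorph (g : 𝔼 ≃ₗ[ℝ] 𝔼) (S T : TensorField m r s 𝔼) :
    TensorField.Related (linearDiffeomorph g) S T ↔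
      ∀ (x : 𝔼) (β : Fin r → Module.Dual ℝ 𝔼) (v : Fin s → 𝔼),
        valueAt x S (fun a => β a ∘ₗ g.toLinearMap) v = valueAt (g x) T β (fun b => g (v b)) := by
  have h : ∀ x, fderiv ℝ (linearDiffeomorph g) x =
      (g.toContinuousLinearEquiv : 𝔼 →L[ℝ] 𝔼) := fun x =>
    g.toContinuousLinearEquiv.fderiv
  rw [related_iff_fderiv]
  simp only [h]
  rfl

/-- The translation by `a` as a diffeomorphism. -/
noncomputable def translationDiffeomorph (a : 𝔼) : 𝔼 ≃ₘ^∞⟮𝓡 m, 𝓡 m⟯ 𝔼 where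
  toEquiv := Equiv.addRight a
  contMDiff_toFun := contMDiff_iff_contDiff.2 (contDiff_id.add contDiff_const)
  contMDiff_invFun := contMDiff_iff_contDiff.2 (contDiff_id.add contDiff_const)

theorem related_translationDiffeomorph (a : 𝔼) (S T : TensorField m r s 𝔼) :
    TensorField.Related (translationDiffeomorph a) S T ↔ ∀ x, valueAt x S = valueAt (x + a) T := by
  have h : ∀ x, fderiv ℝ (translationDiffeomorph a) x = ContinuousLinearMap.id ℝ 𝔼 := by
    intro x
    exact (fderiv_add_const (f := fun x : 𝔼 => x) a).trans fderiv_fun_id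
  rw [related_iff_fderiv]
  simp only [h]
  constructor
  · intro H x
    ext β v
    exact H x β v
  · intro H x β v
    exact congrArg (fun R : TensorSpace r s 𝔼 => R β v) (H x)

end Flat

/-! ### Homogeneity under dilations and reduction to one derivative. -/

namespace NaturalOperator

section

variable {m r₁ s₁ r₂ s₂ r₃ s₃ : ℕ}

local notation "𝔼" => EuclideanSpace ℝ (Fin m)

/-- The bilinear map that a bilinear natural operator induces on `ℝ^m`, evaluated at the origin. -/
noncomputable def atZero (Φ : NaturalOperator m r₁ s₁ r₂ s₂ r₃ s₃) (hbil : Φ.IsBilinear) :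
    TensorField m r₁ s₁ 𝔼 →ₗ[ℝ] TensorField m r₂ s₂ 𝔼 →ₗ[ℝ] TensorSpace r₃ s₃ 𝔼 :=
  (LinearMap.mk₂ ℝ (Φ.toFun 𝔼)
    (fun φ φ' ψ => ((hbil 𝔼).2 ψ).map_add φ φ') (fun c φ ψ => ((hbil 𝔼).2 ψ).map_smul c φ)
    (fun φ ψ ψ' => ((hbil 𝔼).1 φ).map_add ψ ψ')
    (fun c φ ψ => ((hbil 𝔼).1 φ).map_smul c ψ)).compr₂ (valueAt 0)

variable {Φ : NaturalOperator m r₁ s₁ r₂ s₂ r₃ s₃} (hbil : Φ.IsBilinear)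

theorem atZero_apply (φ : TensorField m r₁ s₁ 𝔼) (ψ : TensorField m r₂ s₂ 𝔼) :
    Φ.atZero hbil φ ψ = valueAt 0 (Φ.toFun 𝔼 φ ψ) :=
  rfl

theorem atZero_of_related (g : 𝔼 ≃ₗ[ℝ] 𝔼) {φ φ' : TensorField m r₁ s₁ 𝔼}
    {ψ ψ' : TensorField m r₂ s₂ 𝔼} (hφ : TensorField.Related (linearDiffeomorph g) φ φ')
    (hψ : TensorField.Related (linearDiffeomorph g) ψ ψ')
    (β : Fin r₃ → Module.Dual ℝ 𝔼) (v : Fin s₃ → 𝔼) :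
    Φ.atZero hbil φ ψ (fun a => β a ∘ₗ g.toLinearMap) v =
      Φ.atZero hbil φ' ψ' β (fun b => g (v b)) := by
  have h := (related_linearDiffeomorph g _ _).1
    (Φ.natural 𝔼 𝔼 (linearDiffeomorph g) φ φ' ψ ψ' hφ hψ) 0 β v
  rwa [map_zero] at h

/-- A translation has identity differential, so naturality carries the value at `a` to the origin
without changing the tensor. -/
theorem valueAt_toFun_eq_atZero (a : 𝔼) (φ : TensorField m r₁ s₁ 𝔼) (ψ : TensorField m r₂ s₂ 𝔼) :
    valueAt a (Φ.toFun 𝔼 φ ψ) =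
      Φ.atZero hbil (translateField a φ) (translateField a ψ) := by
  have h := (related_translationDiffeomorph a _ _).1
    (Φ.natural 𝔼 𝔼 (translationDiffeomorph a) (translateField a φ) φ (translateField a ψ) ψ
      ((related_translationDiffeomorph a _ _).2 fun _ => rfl)
      ((related_translationDiffeomorph a _ _).2 fun _ => rfl)) 0
  rw [zero_add] at h
  rw [← h, atZero_apply]

/-- The first argument has the `k`-jet of the zero field at the origin, and a bilinear operator
sends the zero field to zero. -/
theorem atZero_eq_zero_of_vanishesToOrder_left {k : ℕ} (hk : Φ.OrderAtMost k)
    {φ : TensorField m r₁ s₁ 𝔼} (hφ : VanishesToOrder (k + 1) φ) (ψ : TensorField m r₂ s₂ 𝔼) :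
    Φ.atZero hbil φ ψ = 0 := by
  have h : Φ.atZero hbil φ ψ = Φ.atZero hbil 0 ψ :=
    hk 𝔼 φ 0 ψ ψ 0 (sameJet_zero_of_vanishesToOrder hφ) fun _ _ _ _ => rfl
  rw [h, map_zero, LinearMap.zero_apply]

theorem atZero_eq_zero_of_vanishesToOrder_right {k : ℕ} (hk : Φ.OrderAtMost k)
    (φ : TensorField m r₁ s₁ 𝔼) {ψ : TensorField m r₂ s₂ 𝔼} (hψ : VanishesToOrder (k + 1) ψ) :
    Φ.atZero hbil φ ψ = 0 := by
  have h : Φ.atZero hbil φ ψ = Φ.atZero hbil φ 0 :=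
    hk 𝔼 φ φ ψ 0 0 (fun _ _ _ _ => rfl) (sameJet_zero_of_vanishesToOrder hψ)
  rw [h, map_zero]

end

theorem _root_.TensorSpace.apply_comp_smul {r s : ℕ} {V : Type*} [AddCommGroup V] [Module ℝ V]
    (T : TensorSpace r s V) (β : Fin r → Module.Dual ℝ V) (v : Fin s → V) :
    T (fun a => β a ∘ₗ (LinearEquiv.smulOfNeZero ℝ V (2 : ℝ) two_ne_zero).toLinearMap) v =
      2 ^ r * T β v := by
  have h : (fun a => β a ∘ₗ (LinearEquiv.smulOfNeZero ℝ V (2 : ℝ) two_ne_zero).toLinearMap) =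
      fun a => (2 : ℝ) • β a := by
    funext a
    ext w
    simp
  rw [h, T.map_smul_univ]
  simp

theorem _root_.TensorSpace.apply_smul {r s : ℕ} {V : Type*} [AddCommGroup V] [Module ℝ V]
    (T : TensorSpace r s V) (β : Fin r → Module.Dual ℝ V) (v : Fin s → V) :
    T β (fun b => LinearEquiv.smulOfNeZero ℝ V (2 : ℝ) two_ne_zero (v b)) = 2 ^ s * T β v := by
  have h : (fun b => LinearEquiv.smulOfNeZero ℝ V (2 : ℝ) two_ne_zero (v b)) =
      fun b => (2 : ℝ) • v b := by
    funext b
    simp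
  rw [h, MultilinearMap.map_smul_univ]
  simp

/-- Under `x ↦ 2x` each covariant slot of the pullback contributes a factor `2` and each
contravariant slot a factor `1/2`. -/
theorem related_dilate {m r s : ℕ} (T : TensorField m r s (EuclideanSpace ℝ (Fin m))) :
    TensorField.Related (linearDiffeomorph (LinearEquiv.smulOfNeZero ℝ
      (EuclideanSpace ℝ (Fin m)) (2 : ℝ) two_ne_zero)) (((2 : ℝ) ^ s / 2 ^ r) • dilate T) T := by
  rw [related_linearDiffeomorph]
  intro x β v
  have h3 : valueAt x (dilate T) = valueAt ((2 : ℝ) • x) T := rfl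
  rw [TensorSpace.apply_comp_smul, TensorSpace.apply_smul, map_smul, h3, smul_apply, smul_apply,
    smul_eq_mul, LinearEquiv.smulOfNeZero_apply, ← mul_assoc, mul_div_cancel₀ _ (by positivity)]

variable {m p r s : ℕ} {Φ : NaturalOperator m 1 p r s r (s + p)} (hbil : Φ.IsBilinear)

local notation "𝔼" => EuclideanSpace ℝ (Fin m)

theorem _root_.LinearMap.smul_smul_tensorSpace_apply {A B V : Type*} [AddCommMonoid A]
    [AddCommMonoid B] [Module ℝ A] [Module ℝ B] [AddCommGroup V] [Module ℝ V] {r s : ℕ}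
    (f : A →ₗ[ℝ] B →ₗ[ℝ] TensorSpace r s V) (c d : ℝ) (x : A) (y : B)
    (β : Fin r → Module.Dual ℝ V) (v : Fin s → V) :
    f (c • x) (d • y) β v = c * d * f x y β v := by
  simp [mul_assoc, mul_left_comm]

/-- Here `x'` and `y'` play the role of the dilated arguments. The two vanishing hypotheses allow
`x'` to be replaced by `2^a x` and then `y'` by `2^b y`, so `2 f(x,y) = 2^(a+b) f(x,y)`; since `a +
b ≥ 2`, the factors differ. -/
theorem _root_.LinearMap.eq_zero_of_homogeneous {A B V : Type*} [AddCommMonoid A]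
    [AddCommMonoid B] [Module ℝ A] [Module ℝ B] [AddCommGroup V] [Module ℝ V] {r s : ℕ}
    (f : A →ₗ[ℝ] B →ₗ[ℝ] TensorSpace r s V) {x x' : A} {y y' : B} {a b : ℕ} (hab : 2 ≤ a + b)
    (h : ∀ β v, f x' y' β v = 2 * f x y β v) (h₁ : f (x' + (-(2 : ℝ) ^ a) • x) y' = 0)
    (h₂ : f x (y' + (-(2 : ℝ) ^ b) • y) = 0) : f x y = 0 := by
  ext β v
  have h₁' := congrArg (fun R : TensorSpace r s V => R β v) h₁
  have h₂' := congrArg (fun R : TensorSpace r s V => R β v) h₂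
  simp only [map_add, map_smul, LinearMap.add_apply, LinearMap.smul_apply, add_apply, smul_apply,
    zero_apply, smul_eq_mul, h] at h₁' h₂' ⊢
  have h₃ : ((2 : ℝ) ^ (a + b) - 2) * f x y β v = 0 := by
    rw [pow_add]
    linear_combination (-1) * h₁' - (2 : ℝ) ^ a * h₂'
  refine (mul_eq_zero.1 h₃).resolve_left ?_
  have : (2 : ℝ) ^ 2 ≤ 2 ^ (a + b) := pow_le_pow_right₀ (by norm_num) hab
  intro h
  linarith

/-- The arguments have weights `p - 1` and `s - r`, the result has weight `s + p - r`. The excess of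
one is the factor `2`. -/
theorem atZero_dilate_apply (φ : TensorField m 1 p 𝔼) (ψ : TensorField m r s 𝔼)
    (β : Fin r → Module.Dual ℝ 𝔼) (v : Fin (s + p) → 𝔼) :
    Φ.atZero hbil (dilate φ) (dilate ψ) β v = 2 * Φ.atZero hbil φ ψ β v := by
  have h := atZero_of_related hbil _ (related_dilate φ) (related_dilate ψ) β v
  rw [TensorSpace.apply_comp_smul, TensorSpace.apply_smul,
    LinearMap.smul_smul_tensorSpace_apply] at h
  have key : ∀ X Y : ℝ, (2 : ℝ) ^ r * (2 ^ p / 2 ^ 1 * (2 ^ s / 2 ^ r) * X) = 2 ^ (s + p) * Y →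
      X = 2 * Y := by
    intro X Y h
    rw [pow_add] at h
    field_simp at h
    linarith
  exact key _ _ h

/-- Constant fields are fixed by dilation, so the value equals its own double. -/
theorem atZero_constField (T : TensorSpace 1 p 𝔼) (T' : TensorSpace r s 𝔼) :
    Φ.atZero hbil (constField T) (constField T') = 0 := by
  ext β v
  have h := atZero_dilate_apply hbil (constField T) (constField T') β v
  rw [dilate_constField, dilate_constField] at h
  rw [zero_apply, zero_apply]
  linarith

/-- Homogeneity under dilations kills everything of degree at least two. -/
theorem atZero_eq_zero_of_vanishesToOrder {k : ℕ} (hk : Φ.OrderAtMost k) {a b : ℕ}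
    (hab : 2 ≤ a + b) {φ : TensorField m 1 p 𝔼} {ψ : TensorField m r s 𝔼}
    (hφ : VanishesToOrder a φ) (hψ : VanishesToOrder b ψ) : Φ.atZero hbil φ ψ = 0 := by
  -- The induction is on how far `a + b` is from `2k + 2`. Once that bound is reached, `a` or `b` is
  -- at least `k + 1` and finite order applies; otherwise either correction by a dilation raises one
  -- of the orders by one.
  obtain ⟨n, hn⟩ : ∃ n, 2 * k + 2 ≤ a + b + n := ⟨2 * k + 2, by omega⟩
  induction n generalizing a b φ ψ with
  | zero =>
    rcases le_or_gt (k + 1) a with h | h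
    · exact atZero_eq_zero_of_vanishesToOrder_left hbil hk (hφ.mono h) ψ
    · exact atZero_eq_zero_of_vanishesToOrder_right hbil hk φ (hψ.mono (by omega))
  | succ n ih =>
    exact (Φ.atZero hbil).eq_zero_of_homogeneous hab (atZero_dilate_apply hbil φ ψ)
      (ih (by omega) hφ.dilate_sub hψ.dilate (by omega))
      (ih (by omega) hφ hψ.dilate_sub (by omega))

theorem _root_.LinearMap.map_add_add_eq {A B C : Type*} [AddCommMonoid A] [AddCommMonoid B]
    [AddCommMonoid C] [Module ℝ A] [Module ℝ B] [Module ℝ C] (f : A →ₗ[ℝ] B →ₗ[ℝ] C)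
    {a₀ a₁ a₂ : A} {b₀ b₁ b₂ : B} (h₀ : f a₀ b₀ = 0) (h₁ : f a₁ (b₁ + b₂) = 0)
    (h₂ : f a₀ b₂ = 0) (h₃ : f a₂ (b₀ + (b₁ + b₂)) = 0) :
    f (a₀ + (a₁ + a₂)) (b₀ + (b₁ + b₂)) = f a₀ b₁ + f a₁ b₀ := by
  rw [map_add f, map_add f, LinearMap.add_apply, LinearMap.add_apply, h₃, add_zero,
    map_add (f a₁), h₁, add_zero, map_add, map_add, h₀, h₂, add_zero, zero_add]

/-- Only the terms with exactly one derivative contribute. -/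
theorem atZero_eq {k : ℕ} (hk : Φ.OrderAtMost k) (φ : TensorField m 1 p 𝔼)
    (ψ : TensorField m r s 𝔼) :
    Φ.atZero hbil φ ψ = Φ.atZero hbil (constField (valueAt 0 φ)) (linearPart ψ) +
      Φ.atZero hbil (linearPart φ) (constField (valueAt 0 ψ)) := by
  have hφ2 := vanishesToOrder_taylorRemainder φ
  have hψ2 := vanishesToOrder_taylorRemainder ψ
  have hφ1 := vanishesToOrder_linearPart φ
  have hψ1 := vanishesToOrder_linearPart ψ
  -- A field about which nothing is known counts as order zero; paired with a remainder of order two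
  -- it still reaches total order two.
  have h0 : ∀ {r s : ℕ} (T : TensorField m r s 𝔼), VanishesToOrder 0 T :=
    fun T i j l hl => absurd hl (by omega)
  have key := (Φ.atZero hbil).map_add_add_eq (atZero_constField hbil (valueAt 0 φ) (valueAt 0 ψ))
    (atZero_eq_zero_of_vanishesToOrder hbil hk (by norm_num) hφ1
      (hψ1.add (hψ2.mono (by norm_num))))
    (atZero_eq_zero_of_vanishesToOrder hbil hk (by norm_num) (h0 _) hψ2)
    (atZero_eq_zero_of_vanishesToOrder hbil hk (by norm_num) hφ2 (h0 _))
  rwa [← eq_taylor, ← eq_taylor] at key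

end NaturalOperator

/-! ### Splitting and reordering sums over multi-indices. -/

section IndexSums

variable {X : Type*} [Fintype X] {R : Type*} [AddCommMonoid R]

theorem sum_fin_append {a b : ℕ} (F : (Fin (a + b) → X) → R) :
    ∑ I, F I = ∑ x : Fin a → X, ∑ y : Fin b → X, F (Fin.append x y) := by
  rw [← Fintype.sum_prod_type' (fun x y => F (Fin.append x y))]
  exact (Fintype.sum_equiv (Fin.appendEquiv a b) _ _ fun _ => rfl).symm

theorem sum_fin_snoc {n : ℕ} (F : (Fin (n + 1) → X) → R) :
    ∑ t, F t = ∑ t' : Fin n → X, ∑ l : X, F (Fin.snoc (α := fun _ => X) t' l) := by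
  rw [← Fintype.sum_prod_type' (fun t' l => F (Fin.snoc (α := fun _ => X) t' l))]
  refine (Fintype.sum_equiv (⟨fun x => Fin.snoc (α := fun _ => X) x.1 x.2,
    fun t => (Fin.init t, t (Fin.last n)), fun x => ?_, fun t => ?_⟩ :
      (Fin n → X) × X ≃ (Fin (n + 1) → X)) _ _ fun _ => rfl).symm
  · simp
  · simp

theorem sum_fin_one (F : (Fin 1 → X) → R) : ∑ k, F k = ∑ k : X, F ![k] := by
  refine Fintype.sum_equiv (Equiv.funUnique (Fin 1) X) _ _ fun k => ?_
  congr 1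
  funext a
  rw [Subsingleton.elim a 0]
  rfl

/-- Bridges two orders of summation: the left one follows the index blocks of the coefficient
tensors, the right one groups indices by the argument of the trilinear map they belong to. -/
theorem sum_reorder {I M T L J K Q : Type*} [Fintype I] [Fintype M] [Fintype T] [Fintype L]
    [Fintype J] [Fintype K] [Fintype Q] (F : I → M → T → L → J → K → Q → R) :
    ∑ i, ∑ μ, ∑ t, ∑ l, ∑ j, ∑ k, ∑ q, F i μ t l j k q =
      ∑ x : K × M, ∑ l, ∑ y : Q × T, ∑ z : I × J, F z.1 x.2 y.2 l z.2 x.1 y.1 := by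
  have h1 : ∑ i, ∑ μ, ∑ t, ∑ l, ∑ j, ∑ k, ∑ q, F i μ t l j k q =
      ∑ a : I × M × T × L × J × K × Q,
        F a.1 a.2.1 a.2.2.1 a.2.2.2.1 a.2.2.2.2.1 a.2.2.2.2.2.1 a.2.2.2.2.2.2 := by
    simp only [Fintype.sum_prod_type]
  have h2 : ∑ x : K × M, ∑ l, ∑ y : Q × T, ∑ z : I × J, F z.1 x.2 y.2 l z.2 x.1 y.1 =
      ∑ b : (K × M) × L × (Q × T) × (I × J),
        F b.2.2.2.1 b.1.2 b.2.2.1.2 b.2.1 b.2.2.2.2 b.1.1 b.2.2.1.1 := by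
    simp only [Fintype.sum_prod_type]
  rw [h1, h2]
  exact Fintype.sum_equiv ⟨fun a => ((a.2.2.2.2.2.1, a.2.1), a.2.2.2.1,
      (a.2.2.2.2.2.2, a.2.2.1), (a.1, a.2.2.2.2.1)),
    fun b => (b.2.2.2.1, b.1.2, b.2.2.1.2, b.2.1, b.2.2.2.2, b.1.1, b.2.2.1.1),
    fun _ => rfl, fun _ => rfl⟩ _ _ fun _ => rfl

end IndexSums

/-! ### Expansion of trilinear maps. -/

section Trilinear

theorem LinearMap.map_sum_smul₃ {X Y Z W : Type*} [AddCommMonoid X] [AddCommMonoid Y]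
    [AddCommMonoid Z] [AddCommMonoid W] [Module ℝ X] [Module ℝ Y] [Module ℝ Z] [Module ℝ W]
    (G : X →ₗ[ℝ] Y →ₗ[ℝ] Z →ₗ[ℝ] W) {ι κ ν : Type*} [Fintype ι] [Fintype κ] [Fintype ν]
    (a : ι → ℝ) (b : κ → ℝ) (c : ν → ℝ) (x : ι → X) (y : κ → Y) (z : ν → Z) :
    G (∑ i, a i • x i) (∑ j, b j • y j) (∑ k, c k • z k) =
      ∑ i, ∑ j, ∑ k, (a i * b j * c k) • G (x i) (y j) (z k) := by
  rw [map_sum G, LinearMap.sum_apply, LinearMap.sum_apply]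
  refine Finset.sum_congr rfl fun i _ => ?_
  rw [map_smul G, LinearMap.smul_apply, LinearMap.smul_apply, map_sum (G (x i)),
    LinearMap.sum_apply,
    Finset.smul_sum]
  refine Finset.sum_congr rfl fun j _ => ?_
  rw [map_smul (G (x i)), LinearMap.smul_apply, map_sum, Finset.smul_sum, Finset.smul_sum]
  refine Finset.sum_congr rfl fun k _ => ?_
  rw [map_smul, smul_smul, smul_smul, mul_assoc]

end Trilinear

/-! ### Coefficient tensors of equivariant trilinear operations. -/

section Coefficients

variable {m r s r₁ s₁ r₂ s₂ r₃ s₃ : ℕ}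

local notation "𝔼" => EuclideanSpace ℝ (Fin m)

/-- The pure tensors in the standard basis. -/
noncomputable def stdTensor (x : (Fin r → Fin m) × (Fin s → Fin m)) : TensorSpace r s 𝔼 :=
  pureTensor (fun a => stdVector (x.1 a)) (fun b => stdCovector (x.2 b))

theorem TensorSpace.eq_sum_stdTensor (T : TensorSpace r s 𝔼) :
    T = ∑ x, T.component x.1 x.2 • stdTensor x := by
  rw [Fintype.sum_prod_type]
  exact TensorSpace.eq_sum eq_sum_stdVector T

theorem component_pureTensor (u : Fin r → 𝔼) (ξ : Fin s → Module.Dual ℝ 𝔼) (i : Fin r → Fin m)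
    (j : Fin s → Fin m) : (pureTensor u ξ).component i j =
      (∏ a, stdCovector (i a) (u a)) * ∏ b, ξ b (stdVector (j b)) :=
  pureTensor_apply _ _ _ _

/-- The expansion in components of a trilinear operation on two tensors and a covector. -/
theorem trilinear_apply_eq_sum
    (G : TensorSpace r₁ s₁ 𝔼 →ₗ[ℝ] Module.Dual ℝ 𝔼 →ₗ[ℝ] TensorSpace r₂ s₂ 𝔼 →ₗ[ℝ]
      TensorSpace r₃ s₃ 𝔼) (S : TensorSpace r₁ s₁ 𝔼) (τ : Module.Dual ℝ 𝔼)
    (T : TensorSpace r₂ s₂ 𝔼) (α : Fin r₃ → Module.Dual ℝ 𝔼) (w : Fin s₃ → 𝔼) :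
    G S τ T α w = ∑ x, ∑ l, ∑ y, ∑ z : (Fin r₃ → Fin m) × (Fin s₃ → Fin m),
      S.component x.1 x.2 * τ (stdVector l) * T.component y.1 y.2 *
        ((∏ a, α a (stdVector (z.1 a))) * ∏ b, stdCovector (z.2 b) (w b)) *
          (G (stdTensor x) (stdCovector l) (stdTensor y)).component z.1 z.2 := by
  conv_lhs => rw [S.eq_sum_stdTensor, T.eq_sum_stdTensor, dual_eq_sum_stdCovector τ,
    LinearMap.map_sum_smul₃]
  simp only [sum_apply, smul_apply]
  refine Finset.sum_congr rfl fun x _ => Finset.sum_congr rfl fun l _ =>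
    Finset.sum_congr rfl fun y _ => ?_
  rw [TensorSpace.apply_eq_sum eq_sum_stdVector, smul_eq_mul,
    ← Fintype.sum_prod_type' (fun (i : Fin r₃ → Fin m) (j : Fin s₃ → Fin m) =>
      (∏ a, α a (stdVector (i a))) * (∏ c, stdCovector (j c) (w c)) *
        (G (stdTensor x) (stdCovector l) (stdTensor y)) (fun a => stdCovector (i a))
          (fun c => stdVector (j c))), Finset.mul_sum]
  refine Finset.sum_congr rfl fun z _ => ?_
  rw [← mul_assoc]
  rfl

/-- The tensor on `ℝ^m` with the given components. -/
noncomputable def ofComponents (c : (Fin r → Fin m) → (Fin s → Fin m) → ℝ) : TensorSpace r s 𝔼 :=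
  ∑ i : Fin r → Fin m, ∑ j : Fin s → Fin m,
    c i j • pureTensor (fun a => stdVector (i a)) (fun b => stdCovector (j b))

theorem component_ofComponents (c : (Fin r → Fin m) → (Fin s → Fin m) → ℝ) (i : Fin r → Fin m)
    (j : Fin s → Fin m) : (ofComponents c).component i j = c i j :=
  sum_smul_pureTensor_apply stdCovector_stdVector c i j

theorem ofComponents_apply (c : (Fin r → Fin m) → (Fin s → Fin m) → ℝ)
    (β : Fin r → Module.Dual ℝ 𝔼) (v : Fin s → 𝔼) :
    ofComponents c β v = ∑ i : Fin r → Fin m, ∑ j : Fin s → Fin m,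
      c i j * ((∏ a, β a (stdVector (i a))) * ∏ b, stdCovector (j b) (v b)) := by
  unfold ofComponents
  simp only [sum_apply, smul_apply, pureTensor_apply, smul_eq_mul]

variable {p : ℕ}

/-- Equivariance under linear automorphisms of a trilinear operation on two tensors and a
covector. -/
def IsEquivariant (G : TensorSpace r₁ s₁ 𝔼 →ₗ[ℝ] Module.Dual ℝ 𝔼 →ₗ[ℝ] TensorSpace r₂ s₂ 𝔼 →ₗ[ℝ]
    TensorSpace r₃ s₃ 𝔼) : Prop :=
  ∀ (g : 𝔼 ≃ₗ[ℝ] 𝔼) (u : Fin r₁ → 𝔼) (ξ : Fin s₁ → Module.Dual ℝ 𝔼) (τ : Module.Dual ℝ 𝔼)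
    (θ : Fin r₂ → 𝔼) (η : Fin s₂ → Module.Dual ℝ 𝔼) (α : Fin r₃ → Module.Dual ℝ 𝔼)
    (w : Fin s₃ → 𝔼),
    G (pureTensor (fun a => g (u a)) (fun b => ξ b ∘ₗ g.symm.toLinearMap))
      (τ ∘ₗ g.symm.toLinearMap)
      (pureTensor (fun a => g (θ a)) (fun b => η b ∘ₗ g.symm.toLinearMap))
      (fun a => α a ∘ₗ g.symm.toLinearMap) (fun b => g (w b)) =
    G (pureTensor u ξ) τ (pureTensor θ η) α w

/-- The coefficient tensor of a trilinear operation, with the covector in the last place. -/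
theorem exists_coefficientTensor_last
    (G : TensorSpace 1 p 𝔼 →ₗ[ℝ] Module.Dual ℝ 𝔼 →ₗ[ℝ] TensorSpace r s 𝔼 →ₗ[ℝ]
      TensorSpace r (s + p) 𝔼) (hG : IsEquivariant G) :
    ∃ A : TensorSpace (r + p + (s + 1)) (s + p + 1 + r) 𝔼, A.IsGLInvariant ∧
      ∀ (i : Fin r → Fin m) (μ : Fin p → Fin m) (t : Fin (s + 1) → Fin m)
        (j : Fin (s + p) → Fin m) (k : Fin 1 → Fin m) (q : Fin r → Fin m),
        A.component (Fin.append (Fin.append i μ) t) (Fin.append (Fin.append j k) q) =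
          (G (stdTensor (k, μ)) (stdCovector (t (Fin.last s)))
            (stdTensor (q, Fin.init t))).component i j := by
  -- Variance is exchanged for inputs: lower indices of the two input tensors are upper indices of
  -- the coefficient tensor, and conversely. The last of the `s + 1` entries of `t` is the covector.
  let c : (Fin (r + p + (s + 1)) → Fin m) → (Fin (s + p + 1 + r) → Fin m) → ℝ := fun I J =>
    (G (stdTensor (fun a => J (Fin.castAdd r (Fin.natAdd (s + p) a)),
        fun b => I (Fin.castAdd (s + 1) (Fin.natAdd r b))))
      (stdCovector (I (Fin.natAdd (r + p) (Fin.last s))))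
      (stdTensor (fun a => J (Fin.natAdd (s + p + 1) a),
        fun b => I (Fin.natAdd (r + p) (Fin.castSucc b))))).component
      (fun a => I (Fin.castAdd (s + 1) (Fin.castAdd p a)))
      (fun b => J (Fin.castAdd r (Fin.castAdd 1 b)))
  have hc : ∀ (i : Fin r → Fin m) (μ : Fin p → Fin m) (t : Fin (s + 1) → Fin m)
      (j : Fin (s + p) → Fin m) (k : Fin 1 → Fin m) (q : Fin r → Fin m),
      c (Fin.append (Fin.append i μ) t) (Fin.append (Fin.append j k) q) =
        (G (stdTensor (k, μ)) (stdCovector (t (Fin.last s)))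
          (stdTensor (q, Fin.init t))).component i j := by
    intro i μ t j k q
    simp only [c, Fin.append_left, Fin.append_right]
    rfl
  -- A description free of bases: the arguments of the coefficient tensor are distributed over `G`
  -- as factors of pure tensors, as the covector and as test arguments. Invariance is then literally
  -- equivariance of `G` on pure tensors.
  have key : ∀ (β : Fin (r + p + (s + 1)) → Module.Dual ℝ 𝔼) (v : Fin (s + p + 1 + r) → 𝔼),
      ofComponents c β v =
        G (pureTensor (fun a => v (Fin.castAdd r (Fin.natAdd (s + p) a)))
            (fun b => β (Fin.castAdd (s + 1) (Fin.natAdd r b))))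
          (β (Fin.natAdd (r + p) (Fin.last s)))
          (pureTensor (fun a => v (Fin.natAdd (s + p + 1) a))
            (fun b => β (Fin.natAdd (r + p) (Fin.castSucc b))))
          (fun a => β (Fin.castAdd (s + 1) (Fin.castAdd p a)))
          (fun b => v (Fin.castAdd r (Fin.castAdd 1 b))) := by
    intro β v
    rw [ofComponents_apply, trilinear_apply_eq_sum]
    simp only [sum_fin_append (a := r + p), sum_fin_append (a := r), sum_fin_snoc (n := s),
      sum_fin_append (a := s + p + 1), sum_fin_append (a := s + p), hc,
      Fin.prod_univ_add (a := r + p),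
      Fin.prod_univ_add (a := r), Fin.prod_univ_add (a := s + p + 1),
      Fin.prod_univ_add (a := s + p), Fin.prod_univ_castSucc (n := s), Fin.append_left,
      Fin.append_right, Fin.snoc_last,
      Fin.snoc_castSucc, Fin.init_snoc, component_pureTensor]
    refine (sum_reorder _).trans ?_
    refine Finset.sum_congr rfl fun x _ => Finset.sum_congr rfl fun l _ =>
      Finset.sum_congr rfl fun y _ => Finset.sum_congr rfl fun z _ => ?_
    ring
  refine ⟨ofComponents c, fun g β v => ?_, fun i μ t j k q => ?_⟩
  · rw [key, key]
    exact hG g _ _ _ _ _ _ _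
  · rw [component_ofComponents, hc]

/-- The coefficient tensor of a trilinear operation, with the covector in the middle. -/
theorem exists_coefficientTensor_middle
    (G : TensorSpace 1 p 𝔼 →ₗ[ℝ] Module.Dual ℝ 𝔼 →ₗ[ℝ] TensorSpace r s 𝔼 →ₗ[ℝ]
      TensorSpace r (s + p) 𝔼) (hG : IsEquivariant G) :
    ∃ A : TensorSpace (r + (p + 1) + s) (s + p + 1 + r) 𝔼, A.IsGLInvariant ∧
      ∀ (i : Fin r → Fin m) (μ : Fin (p + 1) → Fin m) (t : Fin s → Fin m)
        (j : Fin (s + p) → Fin m) (k : Fin 1 → Fin m) (q : Fin r → Fin m),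
        A.component (Fin.append (Fin.append i μ) t) (Fin.append (Fin.append j k) q) =
          (G (stdTensor (k, Fin.init μ)) (stdCovector (μ (Fin.last p)))
            (stdTensor (q, t))).component i j := by
  let c : (Fin (r + (p + 1) + s) → Fin m) → (Fin (s + p + 1 + r) → Fin m) → ℝ := fun I J =>
    (G (stdTensor (fun a => J (Fin.castAdd r (Fin.natAdd (s + p) a)),
        fun b => I (Fin.castAdd s (Fin.natAdd r (Fin.castSucc b)))))
      (stdCovector (I (Fin.castAdd s (Fin.natAdd r (Fin.last p)))))
      (stdTensor (fun a => J (Fin.natAdd (s + p + 1) a),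
        fun b => I (Fin.natAdd (r + (p + 1)) b)))).component
      (fun a => I (Fin.castAdd s (Fin.castAdd (p + 1) a)))
      (fun b => J (Fin.castAdd r (Fin.castAdd 1 b)))
  have hc : ∀ (i : Fin r → Fin m) (μ : Fin (p + 1) → Fin m) (t : Fin s → Fin m)
      (j : Fin (s + p) → Fin m) (k : Fin 1 → Fin m) (q : Fin r → Fin m),
      c (Fin.append (Fin.append i μ) t) (Fin.append (Fin.append j k) q) =
        (G (stdTensor (k, Fin.init μ)) (stdCovector (μ (Fin.last p)))
          (stdTensor (q, t))).component i j := by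
    intro i μ t j k q
    simp only [c, Fin.append_left, Fin.append_right]
    rfl
  -- The same basis-free description, with the covector now as last entry of the block `μ`.
  have key : ∀ (β : Fin (r + (p + 1) + s) → Module.Dual ℝ 𝔼) (v : Fin (s + p + 1 + r) → 𝔼),
      ofComponents c β v =
        G (pureTensor (fun a => v (Fin.castAdd r (Fin.natAdd (s + p) a)))
            (fun b => β (Fin.castAdd s (Fin.natAdd r (Fin.castSucc b)))))
          (β (Fin.castAdd s (Fin.natAdd r (Fin.last p))))
          (pureTensor (fun a => v (Fin.natAdd (s + p + 1) a))
            (fun b => β (Fin.natAdd (r + (p + 1)) b)))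
          (fun a => β (Fin.castAdd s (Fin.castAdd (p + 1) a)))
          (fun b => v (Fin.castAdd r (Fin.castAdd 1 b))) := by
    intro β v
    rw [ofComponents_apply, trilinear_apply_eq_sum]
    simp only [sum_fin_append (a := r + (p + 1)), sum_fin_append (a := r), sum_fin_snoc (n := p),
      sum_fin_append (a := s + p + 1), sum_fin_append (a := s + p), hc,
      Fin.prod_univ_add (a := r + (p + 1)),
      Fin.prod_univ_add (a := r), Fin.prod_univ_add (a := s + p + 1),
      Fin.prod_univ_add (a := s + p), Fin.prod_univ_castSucc (n := p), Fin.append_left,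
      Fin.append_right, Fin.snoc_last,
      Fin.snoc_castSucc, Fin.init_snoc, component_pureTensor]
    -- The covector index now precedes `t`, so these two sums are exchanged to reach the order that
    -- `sum_reorder` expects.
    refine (Finset.sum_congr rfl fun i _ => Finset.sum_congr rfl fun μ _ =>
      Finset.sum_comm).trans ?_
    refine (sum_reorder _).trans ?_
    refine Finset.sum_congr rfl fun x _ => Finset.sum_congr rfl fun l _ =>
      Finset.sum_congr rfl fun y _ => Finset.sum_congr rfl fun z _ => ?_
    ring
  refine ⟨ofComponents c, fun g β v => ?_, fun i μ t j k q => ?_⟩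
  · rw [key, key]
    exact hG g _ _ _ _ _ _ _
  · rw [component_ofComponents, hc]

end Coefficients

/-! ### Trilinear maps obtained by composing bilinear ones. -/

section Trilinear

variable {P Q W X Y Z : Type*} [AddCommMonoid P] [AddCommMonoid Q] [AddCommMonoid W]
  [AddCommMonoid X] [AddCommMonoid Y] [AddCommMonoid Z] [Module ℝ P] [Module ℝ Q] [Module ℝ W]
  [Module ℝ X] [Module ℝ Y] [Module ℝ Z]

/-- The trilinear map `(x, y, z) ↦ f (c x) (l y z)`. -/
def LinearMap.trilinearRight (f : P →ₗ[ℝ] Q →ₗ[ℝ] W) (c : X →ₗ[ℝ] P) (l : Y →ₗ[ℝ] Z →ₗ[ℝ] Q) :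
    X →ₗ[ℝ] Y →ₗ[ℝ] Z →ₗ[ℝ] W where
  toFun x := l.compr₂ (f (c x))
  map_add' x x' := by
    ext y z
    simp
  map_smul' a x := by
    ext y z
    simp

/-- The trilinear map `(x, y, z) ↦ f (l y x) (c z)`. -/
def LinearMap.trilinearLeft (f : P →ₗ[ℝ] Q →ₗ[ℝ] W) (l : Y →ₗ[ℝ] X →ₗ[ℝ] P) (c : Z →ₗ[ℝ] Q) :
    X →ₗ[ℝ] Y →ₗ[ℝ] Z →ₗ[ℝ] W :=
  l.flip.compr₂ (f.compl₂ c)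

end Trilinear

/-! ### Extending chart components to `ℝ^m`. -/

section Extension

variable {m r s : ℕ} {M : Type*} [TopologicalSpace M]
  [ChartedSpace (EuclideanSpace ℝ (Fin m)) M]

local notation "𝔼" => EuclideanSpace ℝ (Fin m)

/-- Near a point of the target of a chart, tensor fields read in the chart extend to `ℝ^m`. -/
theorem exists_flat_extension {e : OpenPartialHomeomorph M 𝔼}
    (he : e ∈ IsManifold.maximalAtlas (𝓡 m) ∞ M) {y : 𝔼} (hy : y ∈ e.target) :
    ∃ B : TopologicalSpace.Opens 𝔼, y ∈ B ∧ (B : Set 𝔼) ⊆ e.target ∧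
      ∀ (r s : ℕ) (T : TensorField m r s M), ∃ T' : TensorField m r s 𝔼,
        ∀ i j, ∀ z ∈ B, coordComponent e T.1 i j z = fieldComp T' i j z := by
  obtain ⟨ε, hε, hball⟩ := Metric.nhds_basis_closedBall.mem_iff.1 (e.open_target.mem_nhds hy)
  -- The cutoff is one on the ball of radius `ε / 2`, which serves as `B` for all fields at once,
  -- and zero outside radius `ε`. The closed ball of radius `ε` lies in the target, so the
  -- meaningless values of components off the target are multiplied by zero.
  let f : ContDiffBump y := ⟨ε / 2, ε, by positivity, by linarith⟩
  refine ⟨⟨Metric.ball y (ε / 2), Metric.isOpen_ball⟩, Metric.mem_ball_self (by positivity),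
    fun z hz => hball (Metric.ball_subset_closedBall
      (Metric.ball_subset_ball (by linarith) hz)), fun r s T => ?_⟩
  refine ⟨flatField (fun z => ofComponents fun i j => f z * coordComponent e T.1 i j z)
    fun i j => ?_, fun i j z hz => ?_⟩
  · simp only [component_ofComponents]
    refine contDiff_iff_contDiffAt.2 fun z => ?_
    by_cases hz : z ∈ e.target
    · exact f.contDiffAt.mul ((T.2 e he i j).contDiffAt (e.open_target.mem_nhds hz))
    · have hz' : z ∈ (Metric.closedBall y ε)ᶜ := fun h => hz (hball h)
      refine (contDiffAt_const (c := (0 : ℝ))).congr_of_eventuallyEq ?_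
      filter_upwards [Metric.isClosed_closedBall.isOpen_compl.mem_nhds hz'] with w hw
      have hw' : ε ≤ dist w y := le_of_lt (by simpa using hw)
      rw [f.zero_of_le_dist hw', zero_mul]
  · rw [fieldComp, valueAt_flatField, component_ofComponents,
      f.one_of_mem_closedBall (Metric.ball_subset_closedBall hz), one_mul]

end Extension

/-! ### The two symbols and the coordinate formula. -/

namespace NaturalOperator

section

variable {m r₁ s₁ r₂ s₂ r₃ s₃ : ℕ} {Φ : NaturalOperator m r₁ s₁ r₂ s₂ r₃ s₃}
  (hbil : Φ.IsBilinear)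

local notation "𝔼" => EuclideanSpace ℝ (Fin m)

/-- The value of a natural operator in a chart is a value at the origin of `ℝ^m`. -/
theorem exists_coordComponent_eq_atZero
    {M : Type} [TopologicalSpace M] [ChartedSpace (EuclideanSpace ℝ (Fin m)) M]
    [IsManifold (𝓡 m) ∞ M] [T2Space M] [SecondCountableTopology M]
    (φ : TensorField m r₁ s₁ M) (ψ : TensorField m r₂ s₂ M)
    {e : OpenPartialHomeomorph M 𝔼} (he : e ∈ IsManifold.maximalAtlas (𝓡 m) ∞ M) {y : 𝔼}
    (hy : y ∈ e.target) :
    ∃ (φ' : TensorField m r₁ s₁ 𝔼) (ψ' : TensorField m r₂ s₂ 𝔼),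
      (∀ i j, coordComponent e (Φ.toFun M φ ψ).1 i j y = (Φ.atZero hbil φ' ψ').component i j) ∧
      (∀ i j, fieldComp φ' i j 0 = coordComponent e φ.1 i j y ∧
        fderiv ℝ (fieldComp φ' i j) 0 = fderiv ℝ (coordComponent e φ.1 i j) y) ∧
      (∀ i j, fieldComp ψ' i j 0 = coordComponent e ψ.1 i j y ∧
        fderiv ℝ (fieldComp ψ' i j) 0 = fderiv ℝ (coordComponent e ψ.1 i j) y) := by
  obtain ⟨B, hyB, hB, hext⟩ := exists_flat_extension he hy
  obtain ⟨φ', hφ'⟩ := hext _ _ φ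
  obtain ⟨ψ', hψ'⟩ := hext _ _ ψ
  have key : ∀ {r s : ℕ} {T : TensorField m r s M} {T' : TensorField m r s 𝔼},
      (∀ i j, ∀ z ∈ B, coordComponent e T.1 i j z = fieldComp T' i j z) → ∀ i j,
      fieldComp (translateField y T') i j 0 = coordComponent e T.1 i j y ∧
        fderiv ℝ (fieldComp (translateField y T') i j) 0 =
          fderiv ℝ (coordComponent e T.1 i j) y := by
    intro r s T T' h i j
    have hev : coordComponent e T.1 i j =ᶠ[nhds y] fieldComp T' i j := by
      filter_upwards [B.2.mem_nhds hyB] with z hz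
      exact h i j z hz
    rw [fieldComp_translateField, fderiv_comp_add_right, zero_add, hev.fderiv_eq]
    refine ⟨?_, rfl⟩
    rw [hev.self_of_nhds]
    exact congrArg _ (zero_add y)
  refine ⟨translateField y φ', translateField y ψ', fun i j => ?_, key hφ', key hψ'⟩
  rw [Φ.coordComponent_eq_of_eqOn he hB (φ' := φ') (ψ' := ψ') ?_ ?_ i j y hyB,
    coordComponent_refl_eq_fieldComp, fieldComp, valueAt_toFun_eq_atZero hbil]
  · simpa only [coordComponent_refl_eq_fieldComp] using hφ'
  · simpa only [coordComponent_refl_eq_fieldComp] using hψ'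

end

variable {m p r s : ℕ} {Φ : NaturalOperator m 1 p r s r (s + p)} (hbil : Φ.IsBilinear)

local notation "𝔼" => EuclideanSpace ℝ (Fin m)

/-- Each of the two terms of `atZero_eq` contains a linear part, which vanishes at the origin and is
therefore invisible to an operator of order zero. -/
theorem isZero_of_orderAtMost_zero (hbil : Φ.IsBilinear) (h : Φ.OrderAtMost 0) : Φ.IsZero := by
  intro M _ _ _ _ _ φ ψ
  refine Subtype.ext (funext fun x => ?_)
  have he := IsManifold.chart_mem_maximalAtlas (I := 𝓡 m) (n := ∞) x
  have hx := mem_chart_source (EuclideanSpace ℝ (Fin m)) x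
  refine coordComponent_ext he hx fun i j => ?_
  obtain ⟨φ', ψ', h1, -, -⟩ := exists_coordComponent_eq_atZero hbil φ ψ he
    ((chartAt (EuclideanSpace ℝ (Fin m)) x).map_source hx)
  have h2 : Φ.atZero hbil φ' ψ' = 0 := by
    rw [atZero_eq hbil h, atZero_eq_zero_of_vanishesToOrder_right hbil h _
      (vanishesToOrder_linearPart ψ'), atZero_eq_zero_of_vanishesToOrder_left hbil h
      (vanishesToOrder_linearPart φ'), add_zero]
  rw [h1, h2]
  rfl

/-- A linear automorphism has the same differential at every point, so it carries constant fields to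
constant fields, acting factor by factor. This and `related_linearField` give the equivariance of
the symbols. -/
theorem related_constField (g : 𝔼 ≃ₗ[ℝ] 𝔼) {r s : ℕ} (u : Fin r → 𝔼)
    (ξ : Fin s → Module.Dual ℝ 𝔼) :
    TensorField.Related (linearDiffeomorph g) (constField (pureTensor u ξ))
      (constField (pureTensor (fun a => g (u a)) (fun b => ξ b ∘ₗ g.symm.toLinearMap))) := by
  rw [related_linearDiffeomorph]
  intro x β v
  simp

theorem related_linearField (g : 𝔼 ≃ₗ[ℝ] 𝔼) {r s : ℕ} (τ : Module.Dual ℝ 𝔼) (u : Fin r → 𝔼)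
    (ξ : Fin s → Module.Dual ℝ 𝔼) :
    TensorField.Related (linearDiffeomorph g) (linearField τ (pureTensor u ξ))
      (linearField (τ ∘ₗ g.symm.toLinearMap)
        (pureTensor (fun a => g (u a)) (fun b => ξ b ∘ₗ g.symm.toLinearMap))) := by
  rw [related_linearDiffeomorph]
  intro x β v
  simp

/-- The part of the operator that differentiates the second argument. -/
noncomputable def symbolRight : TensorSpace 1 p 𝔼 →ₗ[ℝ] Module.Dual ℝ 𝔼 →ₗ[ℝ]
    TensorSpace r s 𝔼 →ₗ[ℝ] TensorSpace r (s + p) 𝔼 :=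
  (Φ.atZero hbil).trilinearRight constField linearFieldₗ

/-- The part of the operator that differentiates the first argument. -/
noncomputable def symbolLeft : TensorSpace 1 p 𝔼 →ₗ[ℝ] Module.Dual ℝ 𝔼 →ₗ[ℝ]
    TensorSpace r s 𝔼 →ₗ[ℝ] TensorSpace r (s + p) 𝔼 :=
  (Φ.atZero hbil).trilinearLeft linearFieldₗ constField

theorem symbolRight_apply (S : TensorSpace 1 p 𝔼) (τ : Module.Dual ℝ 𝔼) (T : TensorSpace r s 𝔼) :
    symbolRight hbil S τ T = Φ.atZero hbil (constField S) (linearField τ T) :=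
  rfl

theorem symbolLeft_apply (S : TensorSpace 1 p 𝔼) (τ : Module.Dual ℝ 𝔼) (T : TensorSpace r s 𝔼) :
    symbolLeft hbil S τ T = Φ.atZero hbil (linearField τ S) (constField T) :=
  rfl

theorem isEquivariant_symbolRight : IsEquivariant (symbolRight hbil) := by
  intro g u ξ τ θ η α w
  rw [symbolRight_apply, symbolRight_apply, ← atZero_of_related hbil g (related_constField g u ξ)
    (related_linearField g τ θ η)]
  congr 2
  funext a
  ext w
  simp

theorem isEquivariant_symbolLeft : IsEquivariant (symbolLeft hbil) := by
  intro g u ξ τ θ η α w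
  rw [symbolLeft_apply, symbolLeft_apply, ← atZero_of_related hbil g (related_linearField g τ u ξ)
    (related_constField g θ η)]
  congr 2
  funext a
  ext w
  simp

theorem _root_.trilinear_component_eq_sum
    (G : TensorSpace 1 p 𝔼 →ₗ[ℝ] Module.Dual ℝ 𝔼 →ₗ[ℝ] TensorSpace r s 𝔼 →ₗ[ℝ]
      TensorSpace r (s + p) 𝔼) (S : TensorSpace 1 p 𝔼) (τ : Module.Dual ℝ 𝔼)
    (T : TensorSpace r s 𝔼) (i : Fin r → Fin m) (j : Fin (s + p) → Fin m) :
    (G S τ T).component i j = ∑ k : Fin m, ∑ μ : Fin p → Fin m, ∑ q : Fin r → Fin m,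
      ∑ t : Fin s → Fin m, (G (stdTensor (![k], μ)) τ (stdTensor (q, t))).component i j *
        S.component ![k] μ * T.component q t := by
  have h := G.map_sum_smul₃ (fun x : (Fin 1 → Fin m) × (Fin p → Fin m) => S.component x.1 x.2)
    -- The covector is left unexpanded, as a sum with a single term of coefficient one.
    (fun _ : Unit => (1 : ℝ))
    (fun y : (Fin r → Fin m) × (Fin s → Fin m) => T.component y.1 y.2) stdTensor (fun _ => τ)
    stdTensor
  rw [← S.eq_sum_stdTensor, ← T.eq_sum_stdTensor, Fintype.sum_unique, one_smul] at h
  rw [h]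
  unfold TensorSpace.component
  simp only [sum_apply, smul_apply, Fintype.sum_unique, Fintype.sum_prod_type, sum_fin_one,
    smul_eq_mul, mul_one]
  refine Finset.sum_congr rfl fun k _ => Finset.sum_congr rfl fun μ _ =>
    Finset.sum_congr rfl fun q _ => Finset.sum_congr rfl fun t _ => ?_
  ring

theorem component_atZero_right (φ : TensorField m 1 p 𝔼) (ψ : TensorField m r s 𝔼)
    (i : Fin r → Fin m) (j : Fin (s + p) → Fin m) :
    (Φ.atZero hbil (constField (valueAt 0 φ)) (linearPart ψ)).component i j =
      ∑ k : Fin m, ∑ μ : Fin p → Fin m, ∑ q : Fin r → Fin m, ∑ t : Fin (s + 1) → Fin m,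
        (symbolRight hbil (stdTensor (![k], μ)) (stdCovector (t (Fin.last s)))
          (stdTensor (q, Fin.init t))).component i j * fieldComp φ ![k] μ 0 *
            fderiv ℝ (fieldComp ψ q (Fin.init t)) 0 (stdVector (t (Fin.last s))) := by
  have h : (Φ.atZero hbil (constField (valueAt 0 φ)) (linearPart ψ)).component i j =
      ∑ l, (symbolRight hbil (valueAt 0 φ) (stdCovector l) (partialAtZero ψ l)).component i j := by
    rw [linearPart, map_sum]
    unfold TensorSpace.component
    simp only [sum_apply]
    rfl
  rw [h, Finset.sum_congr rfl fun l _ => trilinear_component_eq_sum _ _ _ _ i j]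
  simp only [component_partialAtZero, sum_fin_snoc (n := s),
    Fin.init_snoc, Fin.snoc_last]
  -- The sum over the direction of differentiation moves inwards past `k`, `μ` and `q`, to sit
  -- beside `t` as its last index.
  rw [Finset.sum_comm]
  refine Finset.sum_congr rfl fun k _ => ?_
  rw [Finset.sum_comm]
  refine Finset.sum_congr rfl fun μ _ => ?_
  rw [Finset.sum_comm]
  refine Finset.sum_congr rfl fun q _ => ?_
  rw [Finset.sum_comm]
  rfl

theorem component_atZero_left (φ : TensorField m 1 p 𝔼) (ψ : TensorField m r s 𝔼)
    (i : Fin r → Fin m) (j : Fin (s + p) → Fin m) :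
    (Φ.atZero hbil (linearPart φ) (constField (valueAt 0 ψ))).component i j =
      ∑ k : Fin m, ∑ μ : Fin (p + 1) → Fin m, ∑ q : Fin r → Fin m, ∑ t : Fin s → Fin m,
        (symbolLeft hbil (stdTensor (![k], Fin.init μ)) (stdCovector (μ (Fin.last p)))
          (stdTensor (q, t))).component i j * fieldComp ψ q t 0 *
            fderiv ℝ (fieldComp φ ![k] (Fin.init μ)) 0 (stdVector (μ (Fin.last p))) := by
  have h : (Φ.atZero hbil (linearPart φ) (constField (valueAt 0 ψ))).component i j =
      ∑ l, (symbolLeft hbil (partialAtZero φ l) (stdCovector l) (valueAt 0 ψ)).component i j := by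
    rw [linearPart, map_sum, LinearMap.sum_apply]
    unfold TensorSpace.component
    simp only [sum_apply]
    rfl
  rw [h, Finset.sum_congr rfl fun l _ => trilinear_component_eq_sum _ _ _ _ i j]
  simp only [component_partialAtZero, sum_fin_snoc (n := p),
    Fin.init_snoc, Fin.snoc_last]
  -- Here the sum over the direction of differentiation only has to pass `k`, since it becomes the
  -- last entry of `μ`.
  rw [Finset.sum_comm]
  refine Finset.sum_congr rfl fun k _ => ?_
  rw [Finset.sum_comm]
  refine Finset.sum_congr rfl fun μ _ => Finset.sum_congr rfl fun l _ =>
    Finset.sum_congr rfl fun q _ => Finset.sum_congr rfl fun t _ => ?_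
  rw [mul_right_comm]
  rfl

/-- The coordinate formula for a bilinear natural operator of finite order. -/
theorem exists_coordinate_formula (hbil : Φ.IsBilinear) {n : ℕ} (hn : Φ.OrderAtMost n) :
    ∃ (A : TensorSpace (r + p + (s + 1)) (s + p + 1 + r) (EuclideanSpace ℝ (Fin m)))
      (B : TensorSpace (r + (p + 1) + s) (s + p + 1 + r) (EuclideanSpace ℝ (Fin m))),
      A.IsGLInvariant ∧ B.IsGLInvariant ∧
      ∀ (M : Type) [TopologicalSpace M] [ChartedSpace (EuclideanSpace ℝ (Fin m)) M]
        [IsManifold (𝓡 m) ∞ M] [T2Space M] [SecondCountableTopology M]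
        (φ : TensorField m 1 p M) (ψ : TensorField m r s M),
        ∀ e ∈ IsManifold.maximalAtlas (𝓡 m) ∞ M, ∀ y ∈ e.target,
        ∀ (i : Fin r → Fin m) (j : Fin (s + p) → Fin m),
        coordComponent e (Φ.toFun M φ ψ).1 i j y =
          (∑ k : Fin m, ∑ μ : Fin p → Fin m, ∑ q : Fin r → Fin m, ∑ t : Fin (s + 1) → Fin m,
            TensorSpace.component A (Fin.append (Fin.append i μ) t)
                (Fin.append (Fin.append j ![k]) q) *
              coordComponent e φ.1 ![k] μ y *
              fderiv ℝ (coordComponent e ψ.1 q (Fin.init t)) y (stdVector (t (Fin.last s)))) +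
          ∑ k : Fin m, ∑ μ : Fin (p + 1) → Fin m, ∑ q : Fin r → Fin m, ∑ t : Fin s → Fin m,
            TensorSpace.component B (Fin.append (Fin.append i μ) t)
                (Fin.append (Fin.append j ![k]) q) *
              coordComponent e ψ.1 q t y *
              fderiv ℝ (coordComponent e φ.1 ![k] (Fin.init μ)) y
                (stdVector (μ (Fin.last p))) := by
  obtain ⟨A, hA, hAc⟩ := exists_coefficientTensor_last _ (isEquivariant_symbolRight hbil)
  obtain ⟨B, hB, hBc⟩ := exists_coefficientTensor_middle _ (isEquivariant_symbolLeft hbil)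
  refine ⟨A, B, hA, hB, ?_⟩
  intro M _ _ _ _ _ φ ψ e he y hy i j
  obtain ⟨φ', ψ', h, hφ, hψ⟩ := exists_coordComponent_eq_atZero hbil φ ψ he hy
  have hadd : ∀ S T : TensorSpace r (s + p) 𝔼,
      (S + T).component i j = S.component i j + T.component i j := fun _ _ => rfl
  rw [h, atZero_eq hbil hn, hadd, component_atZero_right, component_atZero_left]
  simp only [hAc, hBc, (hφ _ _).1, (hφ _ _).2, (hψ _ _).1, (hψ _ _).2]

end NaturalOperator

/-! ### Jets and the main theorem. -/

section Jets

variable {m r s : ℕ} {M : Type*} [TopologicalSpace M]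
  [ChartedSpace (EuclideanSpace ℝ (Fin m)) M]

theorem SameJet.coordComponent_eq {k : ℕ} {S T : TensorField m r s M} {x : M}
    (h : SameJet k S T x) (i : Fin r → Fin m) (j : Fin s → Fin m) :
    coordComponent (chartAt (EuclideanSpace ℝ (Fin m)) x) S.1 i j
        (chartAt (EuclideanSpace ℝ (Fin m)) x x) =
      coordComponent (chartAt (EuclideanSpace ℝ (Fin m)) x) T.1 i j
        (chartAt (EuclideanSpace ℝ (Fin m)) x x) := by
  simpa using congrArg (fun L => L ![]) (h i j 0 (Nat.zero_le k))

theorem SameJet.fderiv_coordComponent_eq {k : ℕ} (hk : 1 ≤ k) {S T : TensorField m r s M} {x : M}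
    (h : SameJet k S T x) (i : Fin r → Fin m) (j : Fin s → Fin m) :
    fderiv ℝ (coordComponent (chartAt (EuclideanSpace ℝ (Fin m)) x) S.1 i j)
        (chartAt (EuclideanSpace ℝ (Fin m)) x x) =
      fderiv ℝ (coordComponent (chartAt (EuclideanSpace ℝ (Fin m)) x) T.1 i j)
        (chartAt (EuclideanSpace ℝ (Fin m)) x x) := by
  ext v
  simpa [iteratedFDeriv_one_apply] using congrArg (fun L => L ![v]) (h i j 1 hk)

end Jets

theorem theorem1p2 (m p r s : ℕ) (Φ : NaturalOperator m 1 p r s r (s + p))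
    (hbil : Φ.IsBilinear) (hord : ∃ k : ℕ, Φ.OrderAtMost k) :
    Φ.OrderAtMost 1 ∧ (Φ.OrderAtMost 0 → Φ.IsZero) ∧
    ∃ (A : TensorSpace (r + p + (s + 1)) (s + p + 1 + r) (EuclideanSpace ℝ (Fin m)))
      (B : TensorSpace (r + (p + 1) + s) (s + p + 1 + r) (EuclideanSpace ℝ (Fin m))),
      A.IsGLInvariant ∧ B.IsGLInvariant ∧
      ∀ (M : Type) [TopologicalSpace M] [ChartedSpace (EuclideanSpace ℝ (Fin m)) M]
        [IsManifold (𝓡 m) ∞ M] [T2Space M] [SecondCountableTopology M]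
        (φ : TensorField m 1 p M) (ψ : TensorField m r s M),
        ∀ e ∈ IsManifold.maximalAtlas (𝓡 m) ∞ M, ∀ y ∈ e.target,
        ∀ (i : Fin r → Fin m) (j : Fin (s + p) → Fin m),
        coordComponent e (Φ.toFun M φ ψ).1 i j y =
          (∑ k : Fin m, ∑ μ : Fin p → Fin m, ∑ q : Fin r → Fin m, ∑ t : Fin (s + 1) → Fin m,
            TensorSpace.component A (Fin.append (Fin.append i μ) t)
                (Fin.append (Fin.append j ![k]) q) *
              coordComponent e φ.1 ![k] μ y *
              fderiv ℝ (coordComponent e ψ.1 q (Fin.init t)) y (stdVector (t (Fin.last s)))) +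
          ∑ k : Fin m, ∑ μ : Fin (p + 1) → Fin m, ∑ q : Fin r → Fin m, ∑ t : Fin s → Fin m,
            TensorSpace.component B (Fin.append (Fin.append i μ) t)
                (Fin.append (Fin.append j ![k]) q) *
              coordComponent e ψ.1 q t y *
              fderiv ℝ (coordComponent e φ.1 ![k] (Fin.init μ)) y (stdVector (μ (Fin.last p))) := by

  obtain ⟨n, hn⟩ := hord
  obtain ⟨A, B, hA, hB, hformula⟩ := NaturalOperator.exists_coordinate_formula hbil hn
  refine ⟨?_, NaturalOperator.isZero_of_orderAtMost_zero hbil, A, B, hA, hB, hformula⟩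
  -- In the preferred chart at `x` the formula involves only values and first derivatives of the
  -- components, and these are determined by the `1`-jets.
  intro M _ _ _ _ _ φ φ' ψ ψ' x hφ hψ
  have he := IsManifold.chart_mem_maximalAtlas (I := 𝓡 m) (n := ∞) x
  have hx := mem_chart_source (EuclideanSpace ℝ (Fin m)) x
  refine coordComponent_ext he hx fun i j => ?_
  have hy := (chartAt (EuclideanSpace ℝ (Fin m)) x).map_source hx
  rw [hformula M φ ψ _ he _ hy, hformula M φ' ψ' _ he _ hy]
  simp only [hφ.coordComponent_eq, hψ.coordComponent_eq, hφ.fderiv_coordComponent_eq le_rfl,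
    hψ.fderiv_coordComponent_eq le_rfl]
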